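/- Let $\mathbb K$ be a local field, that is, a nondiscrete locally compact field with an absolute value defining its topology, let $V$ be a nonzero finite-dimensional $\mathbb K$-vector space with a norm $\|\cdot\|$ (for instance $V=\mathbb K^d$, $d\ge 1$, with the Euclidean norm if $\mathbb K=\mathbb R$ or $\mathbb C$ and the maximum norm otherwise), and let $G=\operatorname{GL}(V)$. For $g\in G$ let $\|g\|$ be the operator norm and $N(g)=\max(\|g\|,\|g^{-1}\|)$. Let $p>1$ be real and let $\mu$ be a Borel probability measure on $G$ such that $\int_G(\log N(g))^p\,d\mu(g)<\infty$. Write $\mu^{*n}$ for the $n$-th convolution power of $\mu$. Then $\log\|g\|$ is $\mu^{*n}$-integrable for every $n$, and the first Lyapunov exponent $$\lambda_1:=\lim_{n\to\infty}\frac1n\int_G\log\|g\|\,d\mu^{*n}(g)$$ exists as a real number. Moreover, for every $\varepsilon>0$ there are real constants $C_n=C_n(p,\varepsilon,\mu)$, $n\ge1$, with $\sum_{n\ge1}n^{p-2}C_n<\infty$, such that for all $n\ge1$ $$\mu^{*n}\bigl(\{g\in G:\ |\log\|g\|-n\lambda_1|\ge\varepsilon n\}\bigr)\le C_n ,$$ and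 such that, with the same constants, if the subsemigroup $\Gamma_\mu$ of $G$ spanned by the support of $\mu$ acts irreducibly on $V$ (the only $\Gamma_\mu$-invariant subspaces are $0$ and $V$), then for all $n\ge1$ and all $v\in V\setminus\{0\}$ $$\mu^{*n}\Bigl(\Bigl\{g\in G:\ \Bigl|\log\frac{\|gv\|}{\|v\|}-n\lambda_1\Bigr|\ge\varepsilon n\Bigr\}\Bigr)\le C_n .$$ -/

import Mathlib

open MeasureTheory Filter Topology

namespace RandomWalkGL

/-- `GL(V)`, as the group of invertible elements of the normed algebra of (continuous) linear
endomorphisms of `V`. In the finite-dimensional spaces considered below every linear map is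
continuous. The topology is the usual one of the group of units. -/
abbrev GLin (K V : Type*) [NontriviallyNormedField K] [NormedAddCommGroup V] [NormedSpace K V] :
    Type _ := (V →L[K] V)ˣ

/-- The σ-algebra carried by `GL(V)` is the Borel σ-algebra of its topology, so that a `Measure`
on `GLin K V` is a Borel measure. -/
theorem borelSpace_GL (K V : Type*) [NontriviallyNormedField K] [NormedAddCommGroup V]
    [NormedSpace K V] [CompleteSpace V] : BorelSpace (GLin K V) := by
  refine ⟨?_⟩
  have h : IsInducing (Units.val : GLin K V → (V →L[K] V)) := Units.isOpenEmbedding_val.isInducing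
  rw [h.eq_induced]
  exact borel_comap.symm

/-- The `n`-th convolution power `μ * ⋯ * μ` of a measure on a monoid; the `0`-th one is the Dirac
mass at `1`. -/
noncomputable def convPow {G : Type*} [Monoid G] [MeasurableSpace G] (μ : Measure G) :
    ℕ → Measure G
  | 0 => Measure.dirac 1
  | n + 1 => (convPow μ n).mconv μ

section

variable {K V : Type*} [NontriviallyNormedField K] [NormedAddCommGroup V] [NormedSpace K V]

/-- The operator norm `‖g‖` of `g ∈ GL(V)`. -/
noncomputable def opNorm (g : GLin K V) : ℝ := ‖(g : V →L[K] V)‖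

/-- `N(g) = max (‖g‖, ‖g⁻¹‖)`. -/
noncomputable def bigN (g : GLin K V) : ℝ := max (opNorm g) (opNorm g⁻¹)

/-- The first Lyapunov exponent `λ₁ = lim (1/n) ∫ log ‖g‖ dμ^{*n}(g)`. -/
noncomputable def lyapunov (μ : Measure (GLin K V)) : ℝ :=
  limUnder atTop (fun n : ℕ => (1 / (n : ℝ)) * ∫ g, Real.log (opNorm g) ∂(convPow μ n))

/-- `Γ_μ`, the subsemigroup of `GL(V)` spanned by the support of `μ`. -/
def semigroupOf (μ : Measure (GLin K V)) : Subsemigroup (GLin K V) :=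
  Subsemigroup.closure μ.support

/-- The action of a subsemigroup `Γ` of `GL(V)` on `V` is irreducible: `V` is nonzero and the only
`Γ`-invariant subspaces are `0` and `V`. -/
def ActsIrreducibly (Γ : Subsemigroup (GLin K V)) : Prop :=
  Nontrivial V ∧ ∀ W : Submodule K V,
    (∀ g ∈ Γ, ∀ w ∈ W, (g : V →L[K] V) w ∈ W) → W = ⊥ ∨ W = ⊤

end

end RandomWalkGL

/-! Everything is deduced from a Fuk–Nagaev type inequality for a real cocycle `σ` dominated by an
`L^p` function. If all one-step means of `σ` are at most `c`, then an induction on `n` with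
truncated exponential moments (`IsCocycle.tail_le`) bounds the probability of `σ ≥ n(c + ε)` by `n`
times the probability of a single jump of size `δn`, plus `O(n^{-p})`. The weights `n^{p-2}` make
the first term summable exactly because of the moment of order `p`. A companion estimate bounds the
mean positive excess of `σ` over `nc` by `o(n)`. Adding a bounded coboundary reduces control of the
means after `m` steps to control of one-step means.

Upper deviations: `log ‖gu‖ - log ‖u‖` is a cocycle over left translations, and its `m`-step means
are at most `m(λ₁ + ε)` for a suitable `m`.

Lower deviations, irreducible case: let `l` be the growth rate of the smallest mean of `log (‖gv‖ /
‖v‖)` over `v`. The general theorem applied to the opposite cocycle gives the bound with `l` in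
place of `λ₁`, so `λ₁ ≤ l` is what is needed. Directions near which the mean growth is almost
minimal exist by compactness and are permuted by the support of `μ`, so by irreducibility they span
`V`. At vectors near a basis of such directions the cocycle is `L¹`-close to `nl`, and these vectors
control `‖g‖` (`lyapunov_le_of_slow_basis`).

Lower deviations of the norm, reducible case: by `lyapunov_le_max`, an invariant subspace or its
quotient has exponent at least `λ₁`. To see this, conjugate by block scalars so that the
off-diagonal block disappears. The norm of the block is at most a constant times that of `g`, so
induction on the dimension concludes. -/

open scoped ENNReal

namespace RandomWalkGL

/-! ### Convolution powers -/

section ConvPow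

variable {G : Type*} [Monoid G] [MeasurableSpace G] [MeasurableMul₂ G]

instance isProbabilityMeasure_convPow (μ : Measure G) [IsProbabilityMeasure μ] (n : ℕ) :
    IsProbabilityMeasure (convPow μ n) := by
  induction n with
  | zero => exact inferInstanceAs (IsProbabilityMeasure (Measure.dirac 1))
  | succ n ih =>
    exact Measure.isProbabilityMeasure_map (μ := (convPow μ n).prod μ) (by fun_prop)

theorem convPow_one (μ : Measure G) [IsProbabilityMeasure μ] : convPow μ 1 = μ := by
  simp [convPow]

theorem convPow_add (μ : Measure G) [IsProbabilityMeasure μ] (m n : ℕ) :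
    convPow μ (m + n) = (convPow μ m).mconv (convPow μ n) := by
  induction n with
  | zero => simp [convPow]
  | succ n ih => rw [← add_assoc, convPow, ih, convPow, Measure.mconv_assoc]

/-- Markov property. The right factor acts first on a point, so it is the outer variable, on which
the later inductions condition. -/
theorem lintegral_convPow_add (μ : Measure G) [IsProbabilityMeasure μ] (m n : ℕ)
    {f : G → ℝ≥0∞} (hf : Measurable f) :
    ∫⁻ g, f g ∂(convPow μ (m + n)) = ∫⁻ h, ∫⁻ g, f (g * h) ∂(convPow μ m) ∂(convPow μ n) := by
  rw [convPow_add, Measure.lintegral_mconv hf, lintegral_lintegral_swap]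
  exact (hf.comp measurable_mul).aemeasurable

theorem lintegral_convPow_succ (μ : Measure G) [IsProbabilityMeasure μ] (n : ℕ)
    {f : G → ℝ≥0∞} (hf : Measurable f) :
    ∫⁻ g, f g ∂(convPow μ (n + 1)) = ∫⁻ h, ∫⁻ g, f (g * h) ∂(convPow μ n) ∂μ := by
  rw [lintegral_convPow_add μ n 1 hf, convPow_one]

theorem integral_convPow_add (μ : Measure G) [IsProbabilityMeasure μ] (m n : ℕ)
    {f : G → ℝ} (hf : Integrable f (convPow μ (m + n))) :
    ∫ g, f g ∂(convPow μ (m + n)) = ∫ h, ∫ g, f (g * h) ∂(convPow μ m) ∂(convPow μ n) := by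
  rw [convPow_add] at hf ⊢
  rw [Measure.mconv] at hf ⊢
  have h2 := (integrable_map_measure hf.1 (by fun_prop)).1 hf
  rw [integral_map (by fun_prop) hf.1, integral_prod_symm (fun z : G × G => f (z.1 * z.2)) h2]

theorem integrable_convPow_add (μ : Measure G) [IsProbabilityMeasure μ] (m n : ℕ)
    {f : G → ℝ} (hf : Integrable f (convPow μ (m + n))) :
    Integrable (fun h => ∫ g, f (g * h) ∂(convPow μ m)) (convPow μ n) := by
  rw [convPow_add, Measure.mconv] at hf
  exact ((integrable_map_measure hf.1 (by fun_prop)).1 hf).integral_prod_right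

/-- A subadditive nonnegative function which is integrable for `μ` is integrable for the
convolution powers of `μ`. -/
theorem integrable_convPow_of_subadditive (μ : Measure G) [IsProbabilityMeasure μ] {ξ : G → ℝ}
    (hm : Measurable ξ) (h0 : ∀ g, 0 ≤ ξ g) (hmul : ∀ g h, ξ (g * h) ≤ ξ g + ξ h)
    (hξ : Integrable ξ μ) (n : ℕ) : Integrable ξ (convPow μ n) := by
  induction n with
  | zero =>
    rw [convPow]
    exact (integrable_const (ξ 1)).congr (by
      rw [EventuallyEq, ae_dirac_iff (measurableSet_eq_fun measurable_const hm)])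
  | succ n ih =>
    rw [convPow, Measure.mconv, integrable_map_measure hm.aestronglyMeasurable (by fun_prop)]
    refine ((ih.comp_fst μ).add (hξ.comp_snd (convPow μ n))).mono'
      (hm.comp measurable_mul).aestronglyMeasurable (.of_forall fun x => ?_)
    simpa [abs_of_nonneg (h0 _)] using hmul x.1 x.2

theorem integral_convPow_subadditive (μ : Measure G) [IsProbabilityMeasure μ] {f : G → ℝ}
    (hf : ∀ n, Integrable f (convPow μ n)) (hmul : ∀ g h, f (g * h) ≤ f g + f h) :
    Subadditive fun n => ∫ g, f g ∂(convPow μ n) := by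
  intro m n
  simp only
  rw [integral_convPow_add μ m n (hf _)]
  have hfm : ∀ h, ∀ k, ∫ g, f g + f h ∂(convPow μ k) = ∫ g, f g ∂(convPow μ k) + f h := by
    intro h k
    rw [integral_add (hf k) (integrable_const _)]; simp
  have hae : ∀ᵐ h ∂(convPow μ n), Integrable (fun g => f (g * h)) (convPow μ m) := by
    have := hf (m + n)
    rw [convPow_add, Measure.mconv] at this
    exact ((integrable_map_measure this.1 (by fun_prop)).1 this).prod_left_ae
  calc ∫ h, ∫ g, f (g * h) ∂(convPow μ m) ∂(convPow μ n)
      ≤ ∫ h, (∫ g, f g ∂(convPow μ m) + f h) ∂(convPow μ n) := by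
        refine integral_mono_ae (integrable_convPow_add μ m n (hf _))
          ((integrable_const _).add (hf n)) ?_
        filter_upwards [hae] with h hh
        rw [← hfm h m]
        exact integral_mono hh ((hf m).add (integrable_const _)) fun g => hmul g h
    _ = _ := by
        rw [integral_add (integrable_const _) (hf n)]; simp

end ConvPow

/-! ### Truncated exponential moments of dominated cocycles -/

section Cocycle

variable {G X : Type*} [Monoid G] [MeasurableSpace G]

/-- A real cocycle `σ` over the action `act` of `G` on `X`, measurable in the group variable. -/
structure IsCocycle (act : G → X → X) (σ : G → X → ℝ) : Prop where
  measurable : ∀ x, Measurable fun g => σ g x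
  act_one : ∀ x, act 1 x = x
  act_mul : ∀ g h x, act (g * h) x = act g (act h x)
  map_one : ∀ x, σ 1 x = 0
  map_mul : ∀ g h x, σ (g * h) x = σ g (act h x) + σ h x

theorem IsCocycle.neg {act : G → X → X} {σ : G → X → ℝ} (hσ : IsCocycle act σ) :
    IsCocycle act fun g x => -σ g x where
  measurable x := (hσ.measurable x).neg
  act_one := hσ.act_one
  act_mul := hσ.act_mul
  map_one x := by simp [hσ.map_one]
  map_mul g h x := by simp only [hσ.map_mul]; ring

/-- Termwise comparison of the two power series, after extracting the factor `(z / B) ^ 2`. -/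
theorem exp_sub_one_sub_le {z B : ℝ} (hB : 0 < B) (hz : |z| ≤ B) :
    Real.exp z - 1 - z ≤ (z / B) ^ 2 * Real.exp B := by
  have key : ∀ y : ℝ, HasSum (fun n : ℕ => y ^ (n + 2) / (n + 2).factorial)
      (Real.exp y - 1 - y) := by
    intro y
    have h := NormedSpace.expSeries_div_hasSum_exp y
    rw [← Real.exp_eq_exp_ℝ] at h
    have h2 := (hasSum_nat_add_iff' 2).2 h
    simpa [Finset.sum_range_succ, sub_sub] using h2
  have h1 := key z
  have h2 := (key B).mul_left ((z / B) ^ 2)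
  refine (hasSum_le (fun n => ?_) h1 h2).trans ?_
  · have : z ^ (n + 2) ≤ (z / B) ^ 2 * B ^ (n + 2) := by
      have e : (z / B) ^ 2 * B ^ (n + 2) = z ^ 2 * B ^ n := by field_simp; ring
      rw [e, pow_add, mul_comm]
      refine mul_le_mul_of_nonneg_left ?_ (sq_nonneg _)
      exact (le_abs_self _).trans (by rw [abs_pow]; exact pow_le_pow_left₀ (abs_nonneg _) hz n)
    rw [← mul_div_assoc]
    gcongr
  · gcongr
    linarith

/-- Below the truncation level this is Taylor's formula, with `(f / b) ^ 2 ≤ (η / b) ^ q` because `q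
≤ 2`. Above it the left side is `1`, and the term in `b ^ (1 - q)` compensates for a possibly
negative `s * f`. Keeping `s * f` linear lets the sign of the mean be used after integration. -/
theorem truncated_exp_le {f η b s q : ℝ} (hb : 0 < b) (hs : 0 < s) (hq1 : 1 < q) (hq2 : q ≤ 2)
    (hf : |f| ≤ η) :
    (if η ≤ b then Real.exp (s * f) else 1)
      ≤ 1 + s * f + (s * b ^ (1 - q) + b ^ (-q) * Real.exp (s * b)) * η ^ q := by
  have hη : 0 ≤ η := (abs_nonneg f).trans hf
  have hηq : 0 ≤ η ^ q := Real.rpow_nonneg hη q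
  split_ifs with h
  · have h1 := exp_sub_one_sub_le (z := s * f) (B := s * b) (by positivity)
      (by rw [abs_mul, abs_of_pos hs]; gcongr; exact hf.trans h)
    have h2 : (s * f / (s * b)) ^ 2 ≤ b ^ (-q) * η ^ q := by
      have e1 : s * f / (s * b) = f / b := by field_simp
      rw [e1, ← sq_abs, abs_div, abs_of_pos hb]
      have e2 : b ^ (-q) * η ^ q = (η / b) ^ q := by
        rw [Real.div_rpow hη hb.le, Real.rpow_neg hb.le]; ring
      rw [e2]
      calc (|f| / b) ^ 2 ≤ (η / b) ^ 2 := by gcongr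
        _ = (η / b) ^ (2 : ℝ) := by norm_cast
        _ ≤ (η / b) ^ q := Real.rpow_le_rpow_of_exponent_ge' (by positivity)
            ((div_le_one hb).2 h) (by linarith) hq2
    have h3 := mul_le_mul_of_nonneg_right h2 (Real.exp_pos (s * b)).le
    have h4 : 0 ≤ s * b ^ (1 - q) * η ^ q := by positivity
    linarith
  · push Not at h
    have h1 : η ≤ b ^ (1 - q) * η ^ q := by
      have hη' : 0 < η := hb.trans h
      calc η = η ^ (1 - q) * η ^ q := by rw [← Real.rpow_add hη']; simp
        _ ≤ b ^ (1 - q) * η ^ q := by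
          gcongr ?_ * _
          exact Real.rpow_le_rpow_of_nonpos hb h.le (by linarith)
    have h2 : -f ≤ η := (neg_le_abs f).trans hf
    have h3 : 0 ≤ b ^ (-q) * Real.exp (s * b) * η ^ q := by positivity
    have h4 := mul_le_mul_of_nonneg_left (h2.trans h1) hs.le
    linarith

/-- The logarithm of the growth rate of the truncated exponential moments. -/
noncomputable def truncRate (M q b s : ℝ) : ℝ :=
  (s * b ^ (1 - q) + b ^ (-q) * Real.exp (s * b)) * M

omit [Monoid G] in
theorem lintegral_truncated_exp_le (μ : Measure G) [IsProbabilityMeasure μ] {f η : G → ℝ}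
    {b s q : ℝ} (hb : 0 < b) (hs : 0 < s) (hq1 : 1 < q) (hq2 : q ≤ 2) (hfm : Measurable f)
    (hηm : Measurable η) (hf : ∀ g, |f g| ≤ η g) (hη : Integrable η μ)
    (hηq : Integrable (fun g => η g ^ q) μ) (hmean : ∫ g, f g ∂μ ≤ 0) :
    ∫⁻ g, ENNReal.ofReal (if η g ≤ b then Real.exp (s * f g) else 1) ∂μ
      ≤ ENNReal.ofReal (Real.exp (truncRate (∫ g, η g ^ q ∂μ) q b s)) := by
  have hfi : Integrable f μ := hη.mono' hfm.aestronglyMeasurable (.of_forall hf)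
  set F : G → ℝ := fun g => if η g ≤ b then Real.exp (s * f g) else 1 with hF
  have hFm : Measurable F :=
    Measurable.ite (measurableSet_le hηm measurable_const) (by fun_prop) measurable_const
  have hF0 : ∀ g, 0 ≤ F g := fun g => by simp only [hF]; split_ifs <;> positivity
  have hi1 : Integrable (fun g => 1 + s * f g) μ := (integrable_const _).add (hfi.const_mul s)
  have hi2 := hηq.const_mul (s * b ^ (1 - q) + b ^ (-q) * Real.exp (s * b))
  have hle : ∀ g, F g ≤ 1 + s * f g +
      (s * b ^ (1 - q) + b ^ (-q) * Real.exp (s * b)) * η g ^ q :=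
    fun g => truncated_exp_le hb hs hq1 hq2 (hf g)
  have hFi : Integrable F μ := (hi1.add hi2).mono' hFm.aestronglyMeasurable
    (.of_forall fun g => by rw [Real.norm_of_nonneg (hF0 g)]; exact hle g)
  rw [← ofReal_integral_eq_lintegral_ofReal hFi (.of_forall hF0)]
  refine ENNReal.ofReal_le_ofReal ?_
  calc ∫ g, F g ∂μ ≤ ∫ g, (1 + s * f g +
        (s * b ^ (1 - q) + b ^ (-q) * Real.exp (s * b)) * η g ^ q) ∂μ :=
        integral_mono hFi (hi1.add hi2) hle
    _ = 1 + s * ∫ g, f g ∂μ + truncRate (∫ g, η g ^ q ∂μ) q b s := by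
        rw [integral_add hi1 hi2, integral_add (integrable_const _) (hfi.const_mul s),
          integral_const_mul, integral_const_mul, truncRate]; simp
    _ ≤ truncRate (∫ g, η g ^ q ∂μ) q b s + 1 := by
        have := mul_nonpos_of_nonneg_of_nonpos hs.le hmean
        linarith
    _ ≤ _ := Real.add_one_le_exp _

variable [MeasurableMul₂ G] {act : G → X → X} {σ : G → X → ℝ}

/-- Condition on the first step `h`. A jump `η h > b` is charged to `μ {b < η}`. Otherwise the
threshold `t` drops by `σ h x - c`, and the induction hypothesis at `act h x` yields a factor whose
integral is a truncated exponential moment. The induction closes because the bound is uniform in `x`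
and `t`. -/
theorem IsCocycle.tail_le (hσ : IsCocycle act σ) (μ : Measure G) [IsProbabilityMeasure μ]
    {η : G → ℝ} {c b s q : ℝ} (hb : 0 < b) (hs : 0 < s) (hq1 : 1 < q) (hq2 : q ≤ 2)
    (hηm : Measurable η) (hη : Integrable η μ) (hηq : Integrable (fun g => η g ^ q) μ)
    (hle : ∀ g x, |σ g x - c| ≤ η g) (hmean : ∀ x, ∫ g, (σ g x - c) ∂μ ≤ 0) (n : ℕ) :
    ∀ (x : X) (t : ℝ), convPow μ n {g | n * c + t ≤ σ g x} ≤ n * μ {g | b < η g} +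
      ENNReal.ofReal (Real.exp (-(s * t) + n * truncRate (∫ g, η g ^ q ∂μ) q b s)) := by
  set A := truncRate (∫ g, η g ^ q ∂μ) q b s with hA
  have hms : ∀ (a : ℝ) x, MeasurableSet {g | a ≤ σ g x} :=
    fun a x => measurableSet_le measurable_const (hσ.measurable x)
  have hbm : MeasurableSet {g | b < η g} := measurableSet_lt measurable_const hηm
  induction n with
  | zero =>
    intro x t
    simp only [Nat.cast_zero, zero_mul, zero_add, add_zero]
    by_cases ht : t ≤ 0
    · refine prob_le_one.trans ?_
      rw [← ENNReal.ofReal_one]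
      exact ENNReal.ofReal_le_ofReal (Real.one_le_exp (by nlinarith))
    · rw [convPow, Measure.dirac_apply' _ (hms _ _)]
      simp [hσ.map_one, ht]
  | succ n ih =>
    intro x t
    have h0 : convPow μ (n + 1) {g | ((n + 1 : ℕ) : ℝ) * c + t ≤ σ g x} =
        ∫⁻ h, convPow μ n {g | n * c + (t - (σ h x - c)) ≤ σ g (act h x)} ∂μ := by
      rw [← lintegral_indicator_one (hms _ _), lintegral_convPow_succ μ n
        (measurable_one.indicator (hms _ _))]
      refine lintegral_congr fun h => ?_
      rw [← lintegral_indicator_one (hms _ _)]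
      refine lintegral_congr fun g => ?_
      have : (g * h ∈ {g | ((n + 1 : ℕ) : ℝ) * c + t ≤ σ g x}) ↔
          g ∈ {g | n * c + (t - (σ h x - c)) ≤ σ g (act h x)} := by
        simp only [Set.mem_ofPred_eq, hσ.map_mul]
        push_cast
        constructor <;> intro h <;> linarith
      by_cases hg : g ∈ {g | n * c + (t - (σ h x - c)) ≤ σ g (act h x)}
      · rw [Set.indicator_of_mem (this.2 hg), Set.indicator_of_mem hg]; rfl
      · rw [Set.indicator_of_notMem (fun h' => hg (this.1 h')), Set.indicator_of_notMem hg]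
    rw [h0]
    set E := ENNReal.ofReal (Real.exp (-(s * t) + n * A)) with hE
    set F : G → ℝ≥0∞ := fun h =>
      ENNReal.ofReal (if η h ≤ b then Real.exp (s * (σ h x - c)) else 1) with hF
    have hpt : ∀ h, convPow μ n {g | n * c + (t - (σ h x - c)) ≤ σ g (act h x)} ≤
        {g | b < η g}.indicator 1 h + (n * μ {g | b < η g} + E * F h) := by
      intro h
      by_cases hh : b < η h
      · rw [Set.indicator_of_mem (show h ∈ {g | b < η g} from hh)]
        exact prob_le_one.trans le_self_add
      · refine (ih (act h x) _).trans (le_add_left (add_le_add_right (le_of_eq ?_) _))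
        simp only [hF, hE, if_pos (not_lt.1 hh)]
        rw [← ENNReal.ofReal_mul (Real.exp_pos _).le, ← Real.exp_add]
        congr 2; ring
    have hFm : Measurable F := by
      refine ENNReal.measurable_ofReal.comp (Measurable.ite (measurableSet_le hηm measurable_const)
        ?_ measurable_const)
      exact Real.measurable_exp.comp (((hσ.measurable x).sub_const c).const_mul s)
    refine (lintegral_mono hpt).trans ?_
    rw [lintegral_add_left (measurable_one.indicator hbm), lintegral_indicator_one hbm,
      lintegral_add_left measurable_const, lintegral_const_mul _ hFm, lintegral_const,
      measure_univ, mul_one, ← add_assoc]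
    have hFle := lintegral_truncated_exp_le μ hb hs hq1 hq2 ((hσ.measurable x).sub_const c) hηm
      (fun g => hle g x) hη hηq (hmean x)
    refine add_le_add (le_of_eq ?_) ((mul_le_mul_right hFle E).trans (le_of_eq ?_))
    · push_cast; ring
    · rw [hE, ← ENNReal.ofReal_mul (Real.exp_pos _).le, ← Real.exp_add]
      congr 2; push_cast; rw [← hA]; ring

/-- Same conditioning on the first step, but a large jump is now charged by its size, `η ≤ b ^ (1 -
q) * η ^ q`. The free parameter `κ` is later set to cancel the exponential growth. -/
theorem IsCocycle.lintegral_pos_part_le (hσ : IsCocycle act σ) (μ : Measure G)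
    [IsProbabilityMeasure μ] {η : G → ℝ} {c b s q κ : ℝ} (hb : 0 < b) (hs : 0 < s)
    (hq1 : 1 < q) (hq2 : q ≤ 2) (hκ : 0 ≤ κ)
    (hηm : Measurable η) (hη : Integrable η μ) (hηq : Integrable (fun g => η g ^ q) μ)
    (hle : ∀ g x, |σ g x - c| ≤ η g) (hmean : ∀ x, ∫ g, (σ g x - c) ∂μ ≤ 0) (n : ℕ) :
    ∀ (x : X) (t : ℝ), ∫⁻ g, ENNReal.ofReal (σ g x - n * c + t) ∂(convPow μ n) ≤
      ENNReal.ofReal (s⁻¹ * κ + n * (b ^ (1 - q) * ∫ g, η g ^ q ∂μ)) + ENNReal.ofReal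
        (s⁻¹ * Real.exp (s * t + n * truncRate (∫ g, η g ^ q ∂μ) q b s - κ)) := by
  set A := truncRate (∫ g, η g ^ q ∂μ) q b s with hA
  have hη0 : ∀ x : X, ∀ g, 0 ≤ η g := fun x g => (abs_nonneg _).trans (hle g x)
  induction n with
  | zero =>
    intro x t
    simp only [Nat.cast_zero, zero_mul, add_zero, sub_zero]
    rw [convPow, lintegral_dirac' _ ((hσ.measurable x).add_const t).ennreal_ofReal, hσ.map_one, zero_add,
      ← ENNReal.ofReal_add (by positivity) (by positivity)]
    refine ENNReal.ofReal_le_ofReal ?_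
    -- The start of the induction is `y ≤ κ + exp (y - κ)` at `y = s * t`.
    rw [← mul_add, inv_mul_eq_div, le_div_iff₀ hs]
    linarith [Real.add_one_le_exp (s * t - κ)]
  | succ n ih =>
    intro x t
    have hM0 : 0 ≤ ∫ g, η g ^ q ∂μ := integral_nonneg fun g => Real.rpow_nonneg (hη0 x g) q
    set R := b ^ (1 - q) * ∫ g, η g ^ q ∂μ with hR
    have hR0 : 0 ≤ R := by positivity
    set D := ENNReal.ofReal (s⁻¹ * κ + n * R) with hD
    set E := ENNReal.ofReal (s⁻¹ * Real.exp (s * t + n * A - κ)) with hE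
    set F : G → ℝ≥0∞ := fun h =>
      ENNReal.ofReal (if η h ≤ b then Real.exp (s * (σ h x - c)) else 1) with hF
    have hFm : Measurable F := by
      refine ENNReal.measurable_ofReal.comp (Measurable.ite (measurableSet_le hηm measurable_const)
        ?_ measurable_const)
      exact Real.measurable_exp.comp (((hσ.measurable x).sub_const c).const_mul s)
    have hpt : ∀ h, ∫⁻ g, ENNReal.ofReal (σ (g * h) x - ((n + 1 : ℕ) : ℝ) * c + t)
        ∂(convPow μ n) ≤ D + (E * F h + ENNReal.ofReal (b ^ (1 - q) * η h ^ q)) := by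
      intro h
      by_cases hh : η h ≤ b
      · have e : ∀ g, σ (g * h) x - ((n + 1 : ℕ) : ℝ) * c + t =
            σ g (act h x) - n * c + (t + (σ h x - c)) := by
          intro g; rw [hσ.map_mul]; push_cast; ring
        simp only [e]
        refine (ih (act h x) _).trans (add_le_add_right (le_add_right (le_of_eq ?_)) _)
        simp only [hF, hE, if_pos hh]
        rw [← ENNReal.ofReal_mul (by positivity), mul_assoc s⁻¹, ← Real.exp_add]
        congr 3; ring
      · push Not at hh
        have h1 : η h ≤ b ^ (1 - q) * η h ^ q := by
          have hη' : 0 < η h := hb.trans hh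
          calc η h = η h ^ (1 - q) * η h ^ q := by rw [← Real.rpow_add hη']; simp
            _ ≤ b ^ (1 - q) * η h ^ q := by
              gcongr ?_ * _
              exact Real.rpow_le_rpow_of_nonpos hb hh.le (by linarith)
        have e : ∀ g, ENNReal.ofReal (σ (g * h) x - ((n + 1 : ℕ) : ℝ) * c + t) ≤
            ENNReal.ofReal (σ g (act h x) - n * c + t) +
              ENNReal.ofReal (b ^ (1 - q) * η h ^ q) := by
          intro g
          refine le_trans (ENNReal.ofReal_le_ofReal ?_) ENNReal.ofReal_add_le
          rw [hσ.map_mul]; push_cast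
          linarith [(le_abs_self _).trans (hle h x)]
        refine (lintegral_mono e).trans ?_
        rw [lintegral_add_right _ measurable_const, lintegral_const, measure_univ, mul_one,
          ← add_assoc]
        refine add_le_add_left ((ih (act h x) t).trans (le_of_eq ?_)) _
        simp [hF, not_le.2 hh, hD, hE]
    rw [lintegral_convPow_succ μ n (((hσ.measurable x).sub_const _).add_const t).ennreal_ofReal]
    refine (lintegral_mono hpt).trans ?_
    rw [lintegral_add_left measurable_const, lintegral_add_left (hFm.const_mul _),
      lintegral_const_mul _ hFm, lintegral_const, measure_univ, mul_one,
      ← ofReal_integral_eq_lintegral_ofReal (hηq.const_mul _) (.of_forall fun g => by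
        have := Real.rpow_nonneg (hη0 x g) q
        positivity), integral_const_mul, ← hR]
    have hFle := lintegral_truncated_exp_le μ hb hs hq1 hq2 ((hσ.measurable x).sub_const c) hηm
      (fun g => hle g x) hη hηq (hmean x)
    rw [add_comm (E * _), ← add_assoc, hD, ← ENNReal.ofReal_add (by positivity) hR0]
    refine add_le_add (le_of_eq ?_) ((mul_le_mul_right hFle E).trans (le_of_eq ?_))
    · congr 1; push_cast; ring
    · rw [hE, ← ENNReal.ofReal_mul (by positivity), mul_assoc s⁻¹, ← Real.exp_add]
      congr 3; push_cast; rw [← hA]; ring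

end Cocycle

/-! ### Summability from a moment of order `p` -/

section Summability

/-- At most `y` indices contribute, each at most `y ^ (p - 1)`; the index `0` drops out because `p >
1`. -/
theorem sum_range_rpow_indicator_le {p : ℝ} (hp : 1 < p) {y : ℝ} (hy : 0 ≤ y) (N : ℕ) :
    ∑ n ∈ Finset.range N, (n : ℝ) ^ (p - 1) * (if (n : ℝ) < y then 1 else 0) ≤ y ^ p := by
  have h1 : ∑ n ∈ Finset.range N, (n : ℝ) ^ (p - 1) * (if (n : ℝ) < y then 1 else 0) ≤
      ∑ n ∈ Finset.Icc 1 ⌊y⌋₊, y ^ (p - 1) := by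
    rw [← Finset.sum_filter_ne_zero]
    have hny : ∀ n : ℕ, (n : ℝ) ^ (p - 1) * (if (n : ℝ) < y then (1 : ℝ) else 0) ≠ 0 →
        (n : ℝ) < y := by
      intro n h0
      by_contra h
      exact h0 (by simp [h])
    refine (Finset.sum_le_sum fun n hn => ?_).trans
      (Finset.sum_le_sum_of_subset_of_nonneg (fun n hn => ?_) fun n _ _ => by positivity)
    · have h := hny n (Finset.mem_filter.1 hn).2
      rw [if_pos h, mul_one]
      exact Real.rpow_le_rpow (by positivity) h.le (by linarith)
    · have h0 := (Finset.mem_filter.1 hn).2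
      have hn : n ≠ 0 := by
        rintro rfl
        apply h0
        rw [Nat.cast_zero, Real.zero_rpow (by linarith), zero_mul]
      exact Finset.mem_Icc.2 ⟨Nat.one_le_iff_ne_zero.2 hn, Nat.le_floor (hny n h0).le⟩
  refine h1.trans ?_
  rw [Finset.sum_const, Nat.card_Icc, nsmul_eq_mul]
  simp only [add_tsub_cancel_right]
  rcases hy.eq_or_lt with rfl | hy'
  · simp
    positivity
  calc (⌊y⌋₊ : ℝ) * y ^ (p - 1) ≤ y * y ^ (p - 1) := by
        gcongr; exact Nat.floor_le hy
    _ = y ^ p := by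
        nth_rewrite 1 [← Real.rpow_one y]
        rw [← Real.rpow_add hy']; congr 1; ring

theorem summable_rpow_mul_measure {G : Type*} [MeasurableSpace G] (μ : Measure G)
    [IsProbabilityMeasure μ] {p δ : ℝ} (hp : 1 < p) (hδ : 0 < δ) {η : G → ℝ} (hηm : Measurable η)
    (h0 : ∀ g, 0 ≤ η g) (hηp : Integrable (fun g => η g ^ p) μ) :
    Summable fun n : ℕ => (n : ℝ) ^ (p - 1) * μ.real {g | δ * n < η g} := by
  have hms : ∀ n : ℕ, MeasurableSet {g | δ * n < η g} :=
    fun n => measurableSet_lt measurable_const hηm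
  refine summable_of_sum_range_le (c := ∫ g, (η g / δ) ^ p ∂μ) (fun n => by positivity)
    fun N => ?_
  have e : ∀ n : ℕ, (n : ℝ) ^ (p - 1) * μ.real {g | δ * n < η g} =
      ∫ g, (n : ℝ) ^ (p - 1) * (if (n : ℝ) < η g / δ then 1 else 0) ∂μ := by
    intro n
    rw [integral_const_mul, ← integral_indicator_one (hms n)]
    congr 2
    ext g
    simp only [Set.indicator_apply, Set.mem_ofPred_eq, lt_div_iff₀ hδ, mul_comm (n : ℝ) δ]
    rfl
  have hi : ∀ n : ℕ, Integrable
      (fun g => (n : ℝ) ^ (p - 1) * (if (n : ℝ) < η g / δ then (1 : ℝ) else 0)) μ := by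
    intro n
    refine Integrable.const_mul ?_ _
    refine Integrable.of_bound (C := 1) (Measurable.aestronglyMeasurable ?_)
      (.of_forall fun g => ?_)
    · exact Measurable.ite (measurableSet_lt measurable_const (hηm.div_const δ))
        measurable_const measurable_const
    · split_ifs <;> simp
  rw [Finset.sum_congr rfl fun n _ => e n, ← integral_finsetSum _ fun n _ => hi n]
  refine integral_mono (integrable_finsetSum _ fun n _ => hi n) ?_ fun g => ?_
  · simp_rw [fun g => Real.div_rpow (h0 g) hδ.le p]
    exact hηp.div_const _
  · exact sum_range_rpow_indicator_le hp (div_nonneg (h0 g) hδ.le) N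

/-- Allows the trivial bound `1` for finitely many times, while a bounded error is not yet
negligible against `n`. -/
theorem summable_of_finite_correction {f : ℕ → ℝ} {p : ℝ} (hf : Summable fun n : ℕ =>
    (n : ℝ) ^ p * f n) (N : ℕ) :
    Summable fun n : ℕ => (n : ℝ) ^ p * (f n + if n < N then 1 else 0) := by
  simp_rw [mul_add]
  refine hf.add (summable_of_hasFiniteSupport ((Set.finite_lt_nat N).subset fun n hn => ?_))
  by_contra h
  simp only [Function.mem_support] at hn
  apply hn
  have : ¬ n < N := h
  simp [this]

end Summability

/-! ### Complete convergence under a bound on one-step means -/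

section Tail

variable {G X : Type*} [Monoid G] [MeasurableSpace G] [MeasurableMul₂ G] {act : G → X → X}
  {σ : G → X → ℝ}

theorem integrable_rpow_of_memLp {G : Type*} [MeasurableSpace G] {μ : Measure G}
    [IsProbabilityMeasure μ] {η : G → ℝ} (h0 : ∀ g, 0 ≤ η g) {p q : ℝ} (hq : 0 < q)
    (hqp : q ≤ p) (h : MemLp η (ENNReal.ofReal p) μ) : Integrable (fun g => η g ^ q) μ := by
  have h1 : MemLp η (ENNReal.ofReal q) μ := h.mono_exponent (ENNReal.ofReal_le_ofReal hqp)
  have := h1.integrable_norm_rpow (by simpa using hq) (by simp)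
  simpa [ENNReal.toReal_ofReal hq.le, abs_of_nonneg (h0 _)] using this

/-- Complete convergence for a cocycle dominated by a function in `L^p` and whose one-step means
are at most `c`. -/
theorem IsCocycle.exists_summable_tail_of_mean_le (hσ : IsCocycle act σ) (μ : Measure G)
    [IsProbabilityMeasure μ] {η : G → ℝ} {c p : ℝ} (hp : 1 < p) (hηm : Measurable η)
    (h0 : ∀ g, 0 ≤ η g) (hη : MemLp η (ENNReal.ofReal p) μ)
    (hle : ∀ g x, |σ g x - c| ≤ η g) (hmean : ∀ x, ∫ g, (σ g x - c) ∂μ ≤ 0)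
    {ε : ℝ} (hε : 0 < ε) :
    ∃ C : ℕ → ℝ, Summable (fun n : ℕ => (n : ℝ) ^ (p - 2) * C n) ∧
      ∀ n : ℕ, 1 ≤ n → ∀ x, (convPow μ n).real {g | n * (c + ε) ≤ σ g x} ≤ C n := by
  set q := min p 2 with hq
  have hq1 : 1 < q := lt_min hp (by norm_num)
  have hq2 : q ≤ 2 := min_le_right _ _
  have hqp : q ≤ p := min_le_left _ _
  set M := ∫ g, η g ^ q ∂μ with hM
  have hM0 : 0 ≤ M := integral_nonneg fun g => Real.rpow_nonneg (h0 g) q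
  -- With `b = δ n` and `s = τ log n / n`, this choice gives `exp (-s n ε) = n ^ (-p)` and `exp (s
  -- b) = n ^ (q - 1)`. Hence `n` times the rate stays below the constant `L`.
  set τ := p / ε with hτ
  have hτ0 : 0 < τ := by positivity
  set δ := (q - 1) / τ with hδ
  have hδ0 : 0 < δ := div_pos (by linarith) hτ0
  set L := τ * δ ^ (1 - q) * M / (q - 1) + δ ^ (-q) * M with hL
  have hL0 : 0 ≤ L := add_nonneg (div_nonneg (by positivity) (by linarith)) (by positivity)
  refine ⟨fun n => n * μ.real {g | δ * n < η g} + Real.exp L * (n : ℝ) ^ (-p), ?_, ?_⟩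
  · have h1 := summable_rpow_mul_measure μ hp hδ0 hηm h0 (by
      simpa using integrable_rpow_of_memLp h0 (by linarith) le_rfl hη)
    have h2 : Summable fun n : ℕ => Real.exp L * (1 / (n : ℝ) ^ (2 : ℝ)) :=
      (Real.summable_one_div_nat_rpow.2 (by norm_num)).mul_left _
    refine (h1.add h2).congr fun n => ?_
    rcases Nat.eq_zero_or_pos n with rfl | hn
    · simp [Real.zero_rpow (show p - 1 ≠ 0 by linarith), Real.zero_rpow (show -p ≠ 0 by linarith)]
    · have hn' : (0 : ℝ) < n := by exact_mod_cast hn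
      have e1 : (n : ℝ) ^ (p - 1) = (n : ℝ) ^ (p - 2) * n := by
        nth_rewrite 3 [← Real.rpow_one (n : ℝ)]
        rw [← Real.rpow_add hn']; congr 1; ring
      have e2 : (1 / (n : ℝ) ^ (2 : ℝ)) = (n : ℝ) ^ (p - 2) * (n : ℝ) ^ (-p) := by
        rw [← Real.rpow_add hn', one_div, ← Real.rpow_neg hn'.le]; congr 1; ring
      rw [e1, e2]; ring
  · intro n hn x
    -- At `n = 1` the parameter `s` would vanish, but there the claimed bound is at least `exp L ≥
    -- 1`.
    rcases hn.eq_or_lt with rfl | hn2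
    · refine measureReal_le_one.trans ?_
      have := Real.one_le_exp hL0
      simp only [Nat.cast_one, one_mul, Real.one_rpow, mul_one]
      linarith [measureReal_nonneg (μ := μ) (s := {g | δ < η g})]
    have hn1 : (1 : ℝ) < n := by exact_mod_cast hn2
    have hn0 : (0 : ℝ) < n := by linarith
    have hlog : 0 < Real.log n := Real.log_pos hn1
    have hb : 0 < δ * n := by positivity
    have hs : 0 < τ * Real.log n / n := by positivity
    have hrate : n * truncRate M q (δ * n) (τ * Real.log n / n) ≤ L := by
      have e1 : τ * Real.log n / n * (δ * n) = Real.log n * (q - 1) := by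
        rw [hδ]; field_simp
      have e2 : Real.exp (Real.log n * (q - 1)) = (n : ℝ) ^ (q - 1) := by
        rw [Real.rpow_def_of_pos hn0]
      rw [truncRate, e1, e2, Real.mul_rpow hδ0.le hn0.le, Real.mul_rpow hδ0.le hn0.le]
      have e3 : (n : ℝ) ^ (1 - q) * (n : ℝ) ^ (q - 1) = 1 := by
        rw [← Real.rpow_add hn0]; simp
      have e4 : (n : ℝ) * (n : ℝ) ^ (-q) * (n : ℝ) ^ (q - 1) = 1 := by
        rw [mul_assoc, ← Real.rpow_add hn0, show -q + (q - 1) = -1 by ring, Real.rpow_neg_one,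
          mul_inv_cancel₀ hn0.ne']
      have h5 : Real.log n ≤ (n : ℝ) ^ (q - 1) / (q - 1) :=
        Real.log_le_rpow_div hn0.le (by linarith)
      calc n * ((τ * Real.log n / n * (δ ^ (1 - q) * (n : ℝ) ^ (1 - q)) +
            δ ^ (-q) * (n : ℝ) ^ (-q) * (n : ℝ) ^ (q - 1)) * M)
          = τ * δ ^ (1 - q) * M * (Real.log n * (n : ℝ) ^ (1 - q)) +
            δ ^ (-q) * M * ((n : ℝ) * (n : ℝ) ^ (-q) * (n : ℝ) ^ (q - 1)) := by
            field_simp [hn0.ne']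
        _ ≤ τ * δ ^ (1 - q) * M * ((n : ℝ) ^ (q - 1) / (q - 1) * (n : ℝ) ^ (1 - q)) +
            δ ^ (-q) * M * ((n : ℝ) * (n : ℝ) ^ (-q) * (n : ℝ) ^ (q - 1)) := by gcongr
        _ = τ * δ ^ (1 - q) * M * ((n : ℝ) ^ (1 - q) * (n : ℝ) ^ (q - 1)) / (q - 1) +
            δ ^ (-q) * M * ((n : ℝ) * (n : ℝ) ^ (-q) * (n : ℝ) ^ (q - 1)) := by ring
        _ = L := by rw [e3, e4, hL]; ring
    have hηi : Integrable η μ := by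
      simpa using integrable_rpow_of_memLp h0 one_pos hp.le hη
    have hmain := hσ.tail_le μ hb hs hq1 hq2 hηm hηi
      (integrable_rpow_of_memLp h0 (by linarith) hqp hη) hle hmean n x (n * ε)
    rw [← hM, ← mul_add] at hmain
    have h6 := ENNReal.toReal_mono (by
      refine ENNReal.add_ne_top.2 ⟨ENNReal.mul_ne_top (by simp) (measure_ne_top _ _), ?_⟩
      exact ENNReal.ofReal_ne_top) hmain
    rw [ENNReal.toReal_add (ENNReal.mul_ne_top (by simp) (measure_ne_top _ _))
      ENNReal.ofReal_ne_top, ENNReal.toReal_mul, ENNReal.toReal_natCast,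
      ENNReal.toReal_ofReal (Real.exp_pos _).le] at h6
    refine h6.trans (add_le_add_right ?_ _)
    rw [Real.rpow_def_of_pos hn0, ← Real.exp_add]
    refine Real.exp_le_exp.2 ?_
    have e5 : τ * Real.log n / n * (n * ε) = Real.log n * p := by
      rw [hτ]; field_simp
    rw [e5]
    linarith

/-- Uniform `L¹` upper bound for a cocycle dominated by a function in `L^p` and whose one-step means
are at most `c`. -/
theorem IsCocycle.eventually_lintegral_le_of_mean_le (hσ : IsCocycle act σ) (μ : Measure G)
    [IsProbabilityMeasure μ] {η : G → ℝ} {c p : ℝ} (hp : 1 < p) (hηm : Measurable η)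
    (h0 : ∀ g, 0 ≤ η g) (hη : MemLp η (ENNReal.ofReal p) μ)
    (hle : ∀ g x, |σ g x - c| ≤ η g) (hmean : ∀ x, ∫ g, (σ g x - c) ∂μ ≤ 0)
    {ε : ℝ} (hε : 0 < ε) :
    ∀ᶠ n : ℕ in atTop, ∀ x,
      ∫⁻ g, ENNReal.ofReal (σ g x - n * c) ∂(convPow μ n) ≤ ENNReal.ofReal (ε * n) := by
  set q := min p 2 with hq
  have hq1 : 1 < q := lt_min hp (by norm_num)
  have hq2 : q ≤ 2 := min_le_right _ _
  have hqp : q ≤ p := min_le_left _ _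
  set M := ∫ g, η g ^ q ∂μ with hM
  have hM0 : 0 ≤ M := integral_nonneg fun g => Real.rpow_nonneg (h0 g) q
  have hηi : Integrable η μ := by
    simpa using integrable_rpow_of_memLp h0 one_pos hp.le hη
  -- With `s = b⁻¹` and `κ = n A`, the bound becomes `n b ^ (1 - q) M (2 + e) + b`. So `b` is fixed
  -- large, and the last term is absorbed for large `n`.
  obtain ⟨b, hb1, hb⟩ : ∃ b : ℝ, b ^ (1 - q) * (M * (2 + Real.exp 1)) < ε / 2 ∧ 0 < b := by
    have h1 : Tendsto (fun b : ℝ => b ^ (1 - q) * (M * (2 + Real.exp 1))) atTop (𝓝 0) := by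
      have := (tendsto_rpow_neg_atTop (show 0 < q - 1 by linarith)).mul_const
        (M * (2 + Real.exp 1))
      simpa using this
    exact ((h1.eventually_lt_const (by positivity : 0 < ε / 2)).and
      (eventually_gt_atTop 0)).exists
  filter_upwards [tendsto_natCast_atTop_atTop.eventually_ge_atTop (2 * b / ε)] with n hn x
  set A := truncRate M q b b⁻¹ with hA
  have hAe : A = b ^ (-q) * (1 + Real.exp 1) * M := by
    rw [hA, truncRate, inv_mul_cancel₀ hb.ne']
    have : b⁻¹ * b ^ (1 - q) = b ^ (-q) := by
      rw [← Real.rpow_neg_one, ← Real.rpow_add hb]; congr 1; ring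
    rw [this]; ring
  have hA0 : 0 ≤ A := by rw [hAe]; positivity
  have h := hσ.lintegral_pos_part_le μ (κ := n * A) hb (inv_pos.2 hb) hq1 hq2 (by positivity) hηm
    hηi (integrable_rpow_of_memLp h0 (by linarith) hqp hη) hle hmean n x 0
  simp only [add_zero, mul_zero, zero_add] at h
  refine h.trans ?_
  rw [← hM, ← hA, sub_self, Real.exp_zero, inv_inv, mul_one, ← ENNReal.ofReal_add (by positivity)
    hb.le]
  refine ENNReal.ofReal_le_ofReal ?_
  have e1 : b * b ^ (-q) = b ^ (1 - q) := by
    nth_rewrite 1 [← Real.rpow_one b]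
    rw [← Real.rpow_add hb]; congr 1
  have e2 : b * (n * A) = n * (b ^ (1 - q) * ((1 + Real.exp 1) * M)) := by
    rw [hAe, ← e1]; ring
  rw [e2]
  have h3 : b ≤ ε / 2 * n := by
    rw [div_le_iff₀ hε] at hn; linarith
  have h4 : (n : ℝ) * (b ^ (1 - q) * (M * (2 + Real.exp 1))) ≤ n * (ε / 2) := by gcongr
  linarith

end Tail

/-! ### Means of cocycles and reduction to one step -/

section Mean

variable {G X : Type*} [Monoid G] [MeasurableSpace G] [MeasurableMul₂ G] {act : G → X → X}
  {σ : G → X → ℝ}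

/-- The mean of a cocycle after `n` steps of the random walk. -/
noncomputable def meanCocycle (μ : Measure G) (σ : G → X → ℝ) (n : ℕ) (x : X) : ℝ :=
  ∫ g, σ g x ∂(convPow μ n)

omit [MeasurableMul₂ G] in
theorem IsCocycle.meanCocycle_zero (hσ : IsCocycle act σ) (μ : Measure G) (x : X) :
    meanCocycle μ σ 0 x = 0 := by
  rw [meanCocycle, convPow, integral_dirac' _ _ (hσ.measurable x).stronglyMeasurable, hσ.map_one]

omit [MeasurableMul₂ G] in
theorem IsCocycle.integrable (hσ : IsCocycle act σ) {ν : Measure G} {ξ : G → ℝ}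
    (hξ : Integrable ξ ν) (hle : ∀ g x, |σ g x| ≤ ξ g) (x : X) : Integrable (fun g => σ g x) ν :=
  hξ.mono' (hσ.measurable x).aestronglyMeasurable (.of_forall fun g => hle g x)

omit [MeasurableMul₂ G] in
theorem IsCocycle.abs_meanCocycle_le (hσ : IsCocycle act σ) (μ : Measure G) {ξ : G → ℝ} {n : ℕ}
    (hξ : Integrable ξ (convPow μ n)) (hle : ∀ g x, |σ g x| ≤ ξ g) (x : X) :
    |meanCocycle μ σ n x| ≤ ∫ g, ξ g ∂(convPow μ n) :=
  abs_integral_le_integral_abs.trans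
    (integral_mono (hσ.integrable hξ hle x).abs hξ fun g => hle g x)

/-- `X` carries no σ-algebra; measurability comes from writing `σ g (act h x)` as `σ (g * h) x - σ h
x`. -/
theorem IsCocycle.measurable_meanCocycle (hσ : IsCocycle act σ) (μ : Measure G)
    [IsProbabilityMeasure μ] (n : ℕ) (x : X) :
    Measurable fun h => meanCocycle μ σ n (act h x) := by
  have h1 : StronglyMeasurable fun z : G × G => σ (z.2 * z.1) x - σ z.1 x :=
    (((hσ.measurable x).comp (measurable_snd.mul measurable_fst)).sub
      ((hσ.measurable x).comp measurable_fst)).stronglyMeasurable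
  have h2 : (fun h => meanCocycle μ σ n (act h x)) =
      fun h => ∫ g, (σ (g * h) x - σ h x) ∂(convPow μ n) := by
    ext h
    simp [meanCocycle, hσ.map_mul]
  rw [h2]
  exact h1.integral_prod_right'.measurable

theorem IsCocycle.integrable_meanCocycle (hσ : IsCocycle act σ) (μ : Measure G)
    [IsProbabilityMeasure μ] {ν : Measure G} [IsProbabilityMeasure ν] {ξ : G → ℝ} {n : ℕ}
    (hξ : Integrable ξ (convPow μ n)) (hle : ∀ g x, |σ g x| ≤ ξ g) (x : X) :
    Integrable (fun h => meanCocycle μ σ n (act h x)) ν :=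
  (integrable_const _).mono' (hσ.measurable_meanCocycle μ n x).aestronglyMeasurable
    (.of_forall fun h => hσ.abs_meanCocycle_le μ hξ hle (act h x))

theorem IsCocycle.meanCocycle_add (hσ : IsCocycle act σ) (μ : Measure G)
    [IsProbabilityMeasure μ] {ξ : G → ℝ} (hξ : ∀ n, Integrable ξ (convPow μ n))
    (hle : ∀ g x, |σ g x| ≤ ξ g) (m n : ℕ) (x : X) :
    meanCocycle μ σ (m + n) x =
      ∫ h, meanCocycle μ σ m (act h x) ∂(convPow μ n) + meanCocycle μ σ n x := by
  have h1 : ∀ h, ∫ g, σ (g * h) x ∂(convPow μ m) = meanCocycle μ σ m (act h x) + σ h x := by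
    intro h
    simp only [hσ.map_mul]
    rw [integral_add (hσ.integrable (hξ m) hle _) (integrable_const _)]
    simp [meanCocycle]
  rw [meanCocycle, integral_convPow_add μ m n (hσ.integrable (hξ _) hle x)]
  simp_rw [h1]
  rw [integral_add (hσ.integrable_meanCocycle μ (hξ m) hle x) (hσ.integrable (hξ n) hle x)]
  rfl

theorem IsCocycle.meanCocycle_succ (hσ : IsCocycle act σ) (μ : Measure G)
    [IsProbabilityMeasure μ] {ξ : G → ℝ} (hξ : ∀ n, Integrable ξ (convPow μ n))
    (hle : ∀ g x, |σ g x| ≤ ξ g) (m : ℕ) (x : X) :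
    meanCocycle μ σ (m + 1) x =
      ∫ h, meanCocycle μ σ m (act h x) ∂μ + ∫ h, σ h x ∂μ := by
  rw [hσ.meanCocycle_add μ hξ hle, convPow_one, meanCocycle, convPow_one]

/-- Averaging a cocycle over `m` steps: `σ` is cohomologous, through a bounded function, to a
cocycle whose one-step means are `1 / m` times the `m`-step means of `σ`. -/
theorem IsCocycle.exists_cohomologous (hσ : IsCocycle act σ) (μ : Measure G)
    [IsProbabilityMeasure μ] {ξ : G → ℝ} (hξ : ∀ n, Integrable ξ (convPow μ n))
    (hle : ∀ g x, |σ g x| ≤ ξ g) {m : ℕ} (hm : m ≠ 0) :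
    ∃ (τ : G → X → ℝ) (B : ℝ), IsCocycle act τ ∧ 0 ≤ B ∧ (∀ g x, |τ g x - σ g x| ≤ B) ∧
      ∀ x, ∫ g, τ g x ∂μ = meanCocycle μ σ m x / m := by
  -- Averaging `ψ` over one step shifts the index `i` by one, up to the one-step mean. The
  -- coboundary of `ψ` therefore telescopes to the `m`-step mean divided by `m`, minus the one-step
  -- mean.
  set ψ : X → ℝ := fun x => (∑ i ∈ Finset.range m, meanCocycle μ σ i x) / m with hψ
  have hm' : (m : ℝ) ≠ 0 := by exact_mod_cast hm
  set B := (∑ i ∈ Finset.range m, |∫ g, ξ g ∂(convPow μ i)|) / m with hB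
  have hB0 : 0 ≤ B := div_nonneg (Finset.sum_nonneg fun _ _ => abs_nonneg _) (by positivity)
  have hψB : ∀ x, |ψ x| ≤ B := by
    intro x
    rw [hψ, hB, abs_div, Nat.abs_cast]
    gcongr
    refine (Finset.abs_sum_le_sum_abs _ _).trans (Finset.sum_le_sum fun i _ => ?_)
    exact (hσ.abs_meanCocycle_le μ (hξ i) hle x).trans (le_abs_self _)
  have hψm : ∀ x, Measurable fun g => ψ (act g x) := fun x =>
    (Finset.measurable_sum _ fun i _ => hσ.measurable_meanCocycle μ i x).div_const _
  have hψi : ∀ x, Integrable (fun g => ψ (act g x)) μ := fun x =>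
    (integrable_const B).mono' (hψm x).aestronglyMeasurable (.of_forall fun g => hψB _)
  have hξ1 : Integrable ξ μ := by simpa [convPow_one] using hξ 1
  refine ⟨fun g x => σ g x + (ψ (act g x) - ψ x), 2 * B, ⟨?_, hσ.act_one, hσ.act_mul, ?_, ?_⟩,
    by positivity, ?_, ?_⟩
  · exact fun x => (hσ.measurable x).add ((hψm x).sub_const _)
  · simp [hσ.map_one, hσ.act_one]
  · intro g h x
    simp only [hσ.map_mul, hσ.act_mul]; ring
  · intro g x
    rw [add_sub_cancel_left]
    have h1 := abs_le.1 (hψB (act g x))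
    have h2 := abs_le.1 (hψB x)
    exact abs_le.2 ⟨by linarith, by linarith⟩
  · intro x
    have h0 : Integrable (fun g => ψ (act g x) - ψ x) μ := (hψi x).sub (integrable_const _)
    simp only []
    rw [integral_add (hσ.integrable hξ1 hle x) h0, integral_sub (hψi x) (integrable_const _)]
    have h1 : ∫ g, ψ (act g x) ∂μ =
        (∑ i ∈ Finset.range m, (meanCocycle μ σ (i + 1) x - ∫ h, σ h x ∂μ)) / m := by
      simp only [hψ]
      rw [integral_div, integral_finsetSum _ fun i _ =>
        hσ.integrable_meanCocycle μ (hξ i) hle x]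
      congr 1
      refine Finset.sum_congr rfl fun i _ => ?_
      rw [hσ.meanCocycle_succ μ hξ hle]; ring
    have h2 := Finset.sum_range_sub (fun i => meanCocycle μ σ i x) m
    rw [hσ.meanCocycle_zero, sub_zero, Finset.sum_sub_distrib] at h2
    rw [h1, Finset.sum_sub_distrib, ← h2]
    simp only [hψ, integral_const, probReal_univ, one_smul, Finset.sum_const, Finset.card_range,
      nsmul_eq_mul]
    field_simp
    ring

theorem IsCocycle.exists_cohomologous_of_mean_le (hσ : IsCocycle act σ) (μ : Measure G)
    [IsProbabilityMeasure μ] {ξ : G → ℝ} {c : ℝ} (hξ : ∀ n, Integrable ξ (convPow μ n))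
    (hle : ∀ g x, |σ g x| ≤ ξ g) {m : ℕ} (hm : m ≠ 0)
    (hmean : ∀ x, meanCocycle μ σ m x ≤ m * c) :
    ∃ (τ : G → X → ℝ) (B : ℝ), IsCocycle act τ ∧ 0 ≤ B ∧ (∀ g x, |τ g x - σ g x| ≤ B) ∧
      (∀ g x, |τ g x - c| ≤ ξ g + (B + |c|)) ∧ ∀ x, ∫ g, (τ g x - c) ∂μ ≤ 0 := by
  obtain ⟨τ, B, hτ, hB, hτσ, hτm⟩ := hσ.exists_cohomologous μ hξ hle hm
  have hξ1 : Integrable ξ μ := by simpa [convPow_one] using hξ 1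
  have hm' : (0 : ℝ) < m := by exact_mod_cast Nat.pos_of_ne_zero hm
  have hτle : ∀ g x, |τ g x - c| ≤ ξ g + (B + |c|) := by
    intro g x
    have h1 := abs_le.1 (hτσ g x)
    have h2 := abs_le.1 (hle g x)
    have h3 := neg_abs_le c
    have h4 := le_abs_self c
    exact abs_le.2 ⟨by linarith, by linarith⟩
  have hτi : ∀ x, Integrable (fun g => τ g x) μ := fun x =>
    (hξ1.add (integrable_const B)).mono' (hτ.measurable x).aestronglyMeasurable
      (.of_forall fun g => by
        have h1 := abs_le.1 (hτσ g x)
        have h2 := abs_le.1 (hle g x)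
        exact abs_le.2 ⟨by simp only [Pi.add_apply]; linarith, by simp only [Pi.add_apply]; linarith⟩)
  refine ⟨τ, B, hτ, hB, hτσ, hτle, fun x => ?_⟩
  rw [integral_sub (hτi x) (integrable_const _), hτm]
  simpa [div_le_iff₀' hm'] using hmean x

/-- Complete convergence for a cocycle whose `m`-step means are at most `m c`. -/
theorem IsCocycle.exists_summable_tail (hσ : IsCocycle act σ) (μ : Measure G)
    [IsProbabilityMeasure μ] {ξ : G → ℝ} {c p : ℝ} (hp : 1 < p) (hξm : Measurable ξ)
    (hξ0 : ∀ g, 0 ≤ ξ g) (hξp : MemLp ξ (ENNReal.ofReal p) μ)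
    (hξ : ∀ n, Integrable ξ (convPow μ n)) (hle : ∀ g x, |σ g x| ≤ ξ g)
    {m : ℕ} (hm : m ≠ 0) (hmean : ∀ x, meanCocycle μ σ m x ≤ m * c) {ε : ℝ} (hε : 0 < ε) :
    ∃ C : ℕ → ℝ, Summable (fun n : ℕ => (n : ℝ) ^ (p - 2) * C n) ∧
      ∀ n : ℕ, 1 ≤ n → ∀ x, (convPow μ n).real {g | n * (c + ε) ≤ σ g x} ≤ C n := by
  obtain ⟨τ, B, hτ, hB, hτσ, hτle, hτm⟩ := hσ.exists_cohomologous_of_mean_le μ hξ hle hm hmean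
  obtain ⟨C, hC, htail⟩ := hτ.exists_summable_tail_of_mean_le μ (c := c) hp
    (hξm.add_const (B + |c|)) (fun g => by have := hξ0 g; positivity)
    (hξp.add (memLp_const _)) hτle hτm (half_pos hε)
  -- From time `2 * B / ε` on, the coboundary is at most `n * ε / 2`.
  refine ⟨fun n => C n + if n < ⌈2 * B / ε⌉₊ then 1 else 0,
    summable_of_finite_correction hC _, fun n hn x => ?_⟩
  have hC0 : 0 ≤ C n := measureReal_nonneg.trans (htail n hn x)
  by_cases hN : n < ⌈2 * B / ε⌉₊
  · simp only [if_pos hN]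
    exact measureReal_le_one.trans (by linarith)
  · simp only [if_neg hN, add_zero]
    refine (measureReal_mono fun g hg => ?_).trans (htail n hn x)
    simp only [Set.mem_ofPred_eq] at hg ⊢
    have h1 : 2 * B / ε ≤ n := Nat.ceil_le.1 (not_lt.1 hN)
    rw [div_le_iff₀ hε] at h1
    have h2 := abs_le.1 (hτσ g x)
    linarith

/-- Uniform `L¹` upper bound for a cocycle whose `m`-step means are at most `m c`. -/
theorem IsCocycle.eventually_lintegral_le (hσ : IsCocycle act σ) (μ : Measure G)
    [IsProbabilityMeasure μ] {ξ : G → ℝ} {c p : ℝ} (hp : 1 < p) (hξm : Measurable ξ)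
    (hξ0 : ∀ g, 0 ≤ ξ g) (hξp : MemLp ξ (ENNReal.ofReal p) μ)
    (hξ : ∀ n, Integrable ξ (convPow μ n)) (hle : ∀ g x, |σ g x| ≤ ξ g)
    {m : ℕ} (hm : m ≠ 0) (hmean : ∀ x, meanCocycle μ σ m x ≤ m * c) {ε : ℝ} (hε : 0 < ε) :
    ∀ᶠ n : ℕ in atTop, ∀ x,
      ∫⁻ g, ENNReal.ofReal (σ g x - n * c) ∂(convPow μ n) ≤ ENNReal.ofReal (ε * n) := by
  obtain ⟨τ, B, hτ, hB, hτσ, hτle, hτm⟩ := hσ.exists_cohomologous_of_mean_le μ hξ hle hm hmean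
  have hev := hτ.eventually_lintegral_le_of_mean_le μ (c := c) hp
    (hξm.add_const (B + |c|)) (fun g => by have := hξ0 g; positivity)
    (hξp.add (memLp_const _)) hτle hτm (half_pos hε)
  filter_upwards [hev, tendsto_natCast_atTop_atTop.eventually_ge_atTop (2 * B / ε)] with n hn hnB x
  rw [div_le_iff₀ hε] at hnB
  calc ∫⁻ g, ENNReal.ofReal (σ g x - n * c) ∂(convPow μ n)
      ≤ ∫⁻ g, (ENNReal.ofReal (τ g x - n * c) + ENNReal.ofReal B) ∂(convPow μ n) := by
        refine lintegral_mono fun g => ?_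
        refine le_trans (ENNReal.ofReal_le_ofReal ?_) ENNReal.ofReal_add_le
        have h2 := abs_le.1 (hτσ g x)
        linarith
    _ ≤ ENNReal.ofReal (ε / 2 * n) + ENNReal.ofReal B := by
        rw [lintegral_add_right _ measurable_const, lintegral_const, measure_univ, mul_one]
        exact add_le_add_left (hn x) _
    _ ≤ ENNReal.ofReal (ε * n) := by
        rw [← ENNReal.ofReal_add (by positivity) hB]
        exact ENNReal.ofReal_le_ofReal (by linarith)

end Mean

/-! ### Norm cocycles of `GL(V)` and the upper deviations -/

section LinearGroup

variable {K V : Type*} [NontriviallyNormedField K] [NormedAddCommGroup V] [NormedSpace K V]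

section Norm

theorem opNorm_nonneg (g : GLin K V) : 0 ≤ opNorm g := norm_nonneg _

theorem opNorm_mul_le (g h : GLin K V) : opNorm (g * h) ≤ opNorm g * opNorm h :=
  ContinuousLinearMap.opNorm_comp_le _ _

theorem norm_apply_le (g : GLin K V) (v : V) : ‖(g : V →L[K] V) v‖ ≤ opNorm g * ‖v‖ :=
  ContinuousLinearMap.le_opNorm _ _

theorem inv_apply_apply (g : GLin K V) (v : V) :
    ((g⁻¹ : GLin K V) : V →L[K] V) ((g : V →L[K] V) v) = v :=
  DFunLike.congr_fun g.inv_mul v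

theorem apply_inv_apply (g : GLin K V) (v : V) :
    (g : V →L[K] V) (((g⁻¹ : GLin K V) : V →L[K] V) v) = v :=
  DFunLike.congr_fun g.mul_inv v

theorem apply_ne_zero (g : GLin K V) {v : V} (hv : v ≠ 0) : (g : V →L[K] V) v ≠ 0 := by
  intro h
  apply hv
  rw [← inv_apply_apply g v, h, map_zero]

theorem bigN_inv (g : GLin K V) : bigN g⁻¹ = bigN g := by
  simp [bigN, max_comm]

theorem opNorm_le_bigN (g : GLin K V) : opNorm g ≤ bigN g := le_max_left _ _

theorem opNorm_inv_le_bigN (g : GLin K V) : opNorm g⁻¹ ≤ bigN g := le_max_right _ _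

theorem bigN_nonneg (g : GLin K V) : 0 ≤ bigN g := (opNorm_nonneg g).trans (opNorm_le_bigN g)

theorem bigN_mul_le (g h : GLin K V) : bigN (g * h) ≤ bigN g * bigN h := by
  refine max_le ((opNorm_mul_le g h).trans ?_) ?_
  · exact mul_le_mul (opNorm_le_bigN g) (opNorm_le_bigN h) (opNorm_nonneg h) (bigN_nonneg g)
  · rw [mul_inv_rev]
    refine (opNorm_mul_le _ _).trans ?_
    rw [mul_comm (bigN g)]
    exact mul_le_mul (opNorm_inv_le_bigN h) (opNorm_inv_le_bigN g) (opNorm_nonneg _)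
      (bigN_nonneg h)

variable [Nontrivial V]

theorem opNorm_one : opNorm (1 : GLin K V) = 1 := by
  simp [opNorm]

theorem opNorm_pos (g : GLin K V) : 0 < opNorm g := norm_pos_iff.2 g.ne_zero

theorem one_le_opNorm_mul_inv (g : GLin K V) : 1 ≤ opNorm g * opNorm g⁻¹ := by
  rw [← opNorm_one (K := K) (V := V), ← mul_inv_cancel g]
  exact opNorm_mul_le _ _

theorem one_le_bigN (g : GLin K V) : 1 ≤ bigN g := by
  by_contra! h
  have h1 := one_le_opNorm_mul_inv g
  have h2 := opNorm_le_bigN g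
  have h3 := opNorm_inv_le_bigN g
  have h4 := opNorm_nonneg g
  have h5 := opNorm_nonneg g⁻¹
  nlinarith

theorem bigN_pos (g : GLin K V) : 0 < bigN g := one_pos.trans_le (one_le_bigN g)

theorem log_bigN_nonneg (g : GLin K V) : 0 ≤ Real.log (bigN g) := Real.log_nonneg (one_le_bigN g)

theorem log_bigN_mul_le (g h : GLin K V) :
    Real.log (bigN (g * h)) ≤ Real.log (bigN g) + Real.log (bigN h) := by
  rw [← Real.log_mul (bigN_pos g).ne' (bigN_pos h).ne']
  exact Real.log_le_log (bigN_pos _) (bigN_mul_le g h)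

theorem log_opNorm_mul_le (g h : GLin K V) :
    Real.log (opNorm (g * h)) ≤ Real.log (opNorm g) + Real.log (opNorm h) := by
  rw [← Real.log_mul (opNorm_pos g).ne' (opNorm_pos h).ne']
  exact Real.log_le_log (opNorm_pos _) (opNorm_mul_le g h)

theorem log_opNorm_le (g : GLin K V) : Real.log (opNorm g) ≤ Real.log (bigN g) :=
  Real.log_le_log (opNorm_pos g) (opNorm_le_bigN g)

theorem abs_log_opNorm_mul_sub_le (g u : GLin K V) :
    |Real.log (opNorm (g * u)) - Real.log (opNorm u)| ≤ Real.log (bigN g) := by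
  have h1 := log_opNorm_mul_le g u
  have h2 := log_opNorm_mul_le g⁻¹ (g * u)
  rw [inv_mul_cancel_left] at h2
  have h3 := log_opNorm_le g
  have h4 := log_opNorm_le g⁻¹
  rw [bigN_inv] at h4
  exact abs_le.2 ⟨by linarith, by linarith⟩

theorem abs_log_opNorm_le (g : GLin K V) : |Real.log (opNorm g)| ≤ Real.log (bigN g) := by
  simpa [opNorm_one] using abs_log_opNorm_mul_sub_le g 1

end Norm

section Measurable

variable [LocallyCompactSpace K] [FiniteDimensional K V]

instance secondCountableTopology_GL : SecondCountableTopology (GLin K V) := by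
  have : ProperSpace K := ProperSpace.of_locallyCompactSpace K
  have : ProperSpace (V →L[K] V) := FiniteDimensional.proper K _
  have : CompleteSpace V := FiniteDimensional.complete K V
  exact (Units.isOpenEmbedding_val (R := V →L[K] V)).isInducing.secondCountableTopology

instance borelSpace_GLin : BorelSpace (GLin K V) :=
  have : ProperSpace K := ProperSpace.of_locallyCompactSpace K
  have : CompleteSpace V := FiniteDimensional.complete K V
  borelSpace_GL K V

instance measurableMul₂_GL : MeasurableMul₂ (GLin K V) := inferInstance

omit [LocallyCompactSpace K] [FiniteDimensional K V] in
theorem continuous_opNorm : Continuous (opNorm : GLin K V → ℝ) :=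
  continuous_norm.comp Units.continuous_val

theorem measurable_opNorm : Measurable (opNorm : GLin K V → ℝ) :=
  (continuous_opNorm (K := K) (V := V)).measurable

theorem measurable_bigN : Measurable (bigN : GLin K V → ℝ) :=
  ((continuous_opNorm (K := K) (V := V)).max
    ((continuous_opNorm (K := K) (V := V)).comp continuous_inv)).measurable

theorem measurable_log_bigN : Measurable fun g : GLin K V => Real.log (bigN g) :=
  Real.measurable_log.comp measurable_bigN

omit [LocallyCompactSpace K] [FiniteDimensional K V] in
theorem continuous_apply (v : V) : Continuous fun g : GLin K V => (g : V →L[K] V) v :=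
  (ContinuousLinearMap.apply K V v).continuous.comp Units.continuous_val

end Measurable

section Cocycles

variable [Nontrivial V] [LocallyCompactSpace K] [FiniteDimensional K V]

/-- The norm cocycle of `GL(V)` acting on itself by left translations. -/
noncomputable def opCocycle (g u : GLin K V) : ℝ :=
  Real.log (opNorm (g * u)) - Real.log (opNorm u)

-- At `u = 1` this cocycle is `log ‖g‖`, which is only subadditive by itself; so the cocycle
-- theorems apply to the operator norm.
omit [Nontrivial V] in
theorem isCocycle_opCocycle :
    IsCocycle (fun g u : GLin K V => g * u) opCocycle where
  measurable u := (Real.measurable_log.comp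
    (measurable_opNorm.comp (measurable_id.mul_const u))).sub_const _
  act_one := one_mul
  act_mul := mul_assoc
  map_one u := by simp [opCocycle]
  map_mul g h u := by simp only [opCocycle, mul_assoc]; ring

omit [LocallyCompactSpace K] [FiniteDimensional K V] in
theorem abs_opCocycle_le (g u : GLin K V) : |opCocycle g u| ≤ Real.log (bigN g) :=
  abs_log_opNorm_mul_sub_le g u

/-- The action of `GL(V)` on nonzero vectors. -/
def vecAct (g : GLin K V) (v : {v : V // v ≠ 0}) : {v : V // v ≠ 0} :=
  ⟨(g : V →L[K] V) v, apply_ne_zero g v.2⟩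

/-- The norm cocycle of `GL(V)` acting on nonzero vectors. -/
noncomputable def vecCocycle (g : GLin K V) (v : {v : V // v ≠ 0}) : ℝ :=
  Real.log (‖(g : V →L[K] V) v‖ / ‖(v : V)‖)

omit [Nontrivial V] [LocallyCompactSpace K] [FiniteDimensional K V] in
theorem vecCocycle_eq (g : GLin K V) (v : {v : V // v ≠ 0}) :
    vecCocycle g v = Real.log ‖(g : V →L[K] V) v‖ - Real.log ‖(v : V)‖ :=
  Real.log_div (norm_ne_zero_iff.2 (apply_ne_zero g v.2)) (norm_ne_zero_iff.2 v.2)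

omit [Nontrivial V] in
theorem isCocycle_vecCocycle : IsCocycle (vecAct (K := K) (V := V)) vecCocycle where
  measurable v := Real.measurable_log.comp
    ((continuous_apply (K := K) (v : V)).norm.measurable.div_const _)
  act_one v := by ext; simp [vecAct]
  act_mul g h v := by ext; simp [vecAct]
  map_one v := by simp [vecCocycle, v.2]
  map_mul g h v := by simp [vecCocycle_eq, vecAct]

omit [LocallyCompactSpace K] [FiniteDimensional K V] in
omit [Nontrivial V] in
theorem vecCocycle_le (g : GLin K V) (v : {v : V // v ≠ 0}) :
    vecCocycle g v ≤ Real.log (opNorm g) := by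
  have hv : 0 < ‖(v : V)‖ := norm_pos_iff.2 v.2
  refine Real.log_le_log (div_pos (norm_pos_iff.2 (apply_ne_zero g v.2)) hv) ?_
  rw [div_le_iff₀ hv]
  exact norm_apply_le g v

omit [LocallyCompactSpace K] [FiniteDimensional K V] in
theorem abs_vecCocycle_le (g : GLin K V) (v : {v : V // v ≠ 0}) :
    |vecCocycle g v| ≤ Real.log (bigN g) := by
  have h1 := (vecCocycle_le g v).trans (log_opNorm_le g)
  have h2 := (vecCocycle_le g⁻¹ (vecAct g v)).trans (log_opNorm_le g⁻¹)
  rw [bigN_inv, vecCocycle_eq] at h2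
  simp only [vecAct, inv_apply_apply] at h2
  rw [vecCocycle_eq] at h1 ⊢
  exact abs_le.2 ⟨by linarith, h1⟩

end Cocycles

section Moment

variable [Nontrivial V] [LocallyCompactSpace K] [FiniteDimensional K V]
  {p : ℝ} {μ : Measure (GLin K V)} [IsProbabilityMeasure μ]

omit [IsProbabilityMeasure μ] in
theorem memLp_log_bigN (hp : 1 < p) (hμ : Integrable (fun g => Real.log (bigN g) ^ p) μ) :
    MemLp (fun g => Real.log (bigN g)) (ENNReal.ofReal p) μ := by
  rw [← integrable_norm_rpow_iff measurable_log_bigN.aestronglyMeasurable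
    (by simp; linarith) (by simp)]
  simpa [ENNReal.toReal_ofReal (by linarith : 0 ≤ p), abs_of_nonneg (log_bigN_nonneg _)] using hμ

theorem integrable_log_bigN (hp : 1 < p)
    (hμ : MemLp (fun g => Real.log (bigN g)) (ENNReal.ofReal p) μ) (n : ℕ) :
    Integrable (fun g => Real.log (bigN g)) (convPow μ n) :=
  integrable_convPow_of_subadditive μ measurable_log_bigN log_bigN_nonneg log_bigN_mul_le
    (hμ.integrable (by simpa using hp.le)) n

theorem integrable_log_opNorm (hp : 1 < p)
    (hμ : MemLp (fun g => Real.log (bigN g)) (ENNReal.ofReal p) μ) (n : ℕ) :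
    Integrable (fun g => Real.log (opNorm g)) (convPow μ n) :=
  (integrable_log_bigN hp hμ n).mono'
    (Real.measurable_log.comp measurable_opNorm).aestronglyMeasurable
    (.of_forall fun g => abs_log_opNorm_le g)

theorem integral_log_bigN_le (hp : 1 < p)
    (hμ : MemLp (fun g => Real.log (bigN g)) (ENNReal.ofReal p) μ) (n : ℕ) :
    ∫ g, Real.log (bigN g) ∂(convPow μ n) ≤ n * ∫ g, Real.log (bigN g) ∂μ := by
  have h := integral_convPow_subadditive μ (integrable_log_bigN hp hμ) log_bigN_mul_le
  have h1 := h.apply_mul_add_le n 1 0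
  have h0 : ∫ g, Real.log (bigN g) ∂(convPow μ 0) = 0 := by
    rw [convPow, integral_dirac' _ _ measurable_log_bigN.stronglyMeasurable]
    simp [bigN, opNorm_one]
  simpa [h0, convPow_one] using h1

theorem exists_abs_meanCocycle_le {X : Type*} {act : GLin K V → X → X} {σ : GLin K V → X → ℝ}
    (hσ : IsCocycle act σ) (hle : ∀ g x, |σ g x| ≤ Real.log (bigN g)) (hp : 1 < p)
    (hμ : MemLp (fun g => Real.log (bigN g)) (ENNReal.ofReal p) μ) (n : ℕ) (x : X) :
    |meanCocycle μ σ n x| ≤ n * ∫ g, Real.log (bigN g) ∂μ :=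
  (hσ.abs_meanCocycle_le μ (integrable_log_bigN hp hμ n) hle x).trans (integral_log_bigN_le hp hμ n)

theorem bddBelow_range_div {u : ℕ → ℝ} {L : ℝ} (h : ∀ n : ℕ, |u n| ≤ n * L) :
    BddBelow (Set.range fun n : ℕ => u n / n) := by
  refine ⟨-|L|, ?_⟩
  rintro _ ⟨n, rfl⟩
  rcases Nat.eq_zero_or_pos n with rfl | hn
  · simp
  · have hn' : (0 : ℝ) < n := by exact_mod_cast hn
    simp only []
    rw [le_div_iff₀ hn']
    have h1 := (abs_le.1 (h n)).1
    have h2 := mul_le_mul_of_nonneg_left (le_abs_self L) hn'.le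
    linarith

theorem abs_integral_log_opNorm_le (hp : 1 < p)
    (hμ : MemLp (fun g => Real.log (bigN g)) (ENNReal.ofReal p) μ) (n : ℕ) :
    |∫ g, Real.log (opNorm g) ∂(convPow μ n)| ≤ n * ∫ g, Real.log (bigN g) ∂μ :=
  (abs_integral_le_integral_abs.trans (integral_mono (integrable_log_opNorm hp hμ n).abs
    (integrable_log_bigN hp hμ n) fun g => abs_log_opNorm_le g)).trans (integral_log_bigN_le hp hμ n)

/-- Fekete's lemma: the limit is also the infimum, hence a lower bound at every fixed time. -/
theorem tendsto_lyapunov_and_le (hp : 1 < p)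
    (hμ : MemLp (fun g => Real.log (bigN g)) (ENNReal.ofReal p) μ) :
    Tendsto (fun n : ℕ => (∫ g, Real.log (opNorm g) ∂(convPow μ n)) / n) atTop
      (𝓝 (lyapunov μ)) ∧
    ∀ n : ℕ, n ≠ 0 → n * lyapunov μ ≤ ∫ g, Real.log (opNorm g) ∂(convPow μ n) := by
  have hsub := integral_convPow_subadditive μ (integrable_log_opNorm hp hμ) log_opNorm_mul_le
  have hb := bddBelow_range_div (abs_integral_log_opNorm_le hp hμ)
  have h1 := hsub.tendsto_lim hb
  have h2 : lyapunov μ = hsub.lim := by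
    refine Tendsto.limUnder_eq ?_
    simpa [div_eq_inv_mul] using h1
  refine ⟨h2 ▸ h1, fun n hn => ?_⟩
  have hn' : (0 : ℝ) < n := by exact_mod_cast Nat.pos_of_ne_zero hn
  rw [h2, mul_comm, ← le_div_iff₀ hn']
  exact hsub.lim_le_div hb hn

theorem exists_meanCocycle_opCocycle_le (hp : 1 < p)
    (hμ : MemLp (fun g => Real.log (bigN g)) (ENNReal.ofReal p) μ) {ε : ℝ} (hε : 0 < ε) :
    ∃ m : ℕ, m ≠ 0 ∧ ∀ u, meanCocycle μ (opCocycle (K := K) (V := V)) m u ≤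
      m * (lyapunov μ + ε) := by
  have h := (tendsto_lyapunov_and_le hp hμ).1.eventually_lt_const
    (show lyapunov μ < lyapunov μ + ε by linarith)
  obtain ⟨m, hm, hm0⟩ := (h.and (eventually_gt_atTop 0)).exists
  refine ⟨m, hm0.ne', fun u => ?_⟩
  have hm' : (0 : ℝ) < m := by exact_mod_cast hm0
  rw [div_lt_iff₀' hm'] at hm
  refine (integral_mono (isCocycle_opCocycle.integrable (integrable_log_bigN hp hμ m)
    abs_opCocycle_le u) (integrable_log_opNorm hp hμ m) fun g => ?_).trans hm.le
  have := log_opNorm_mul_le g u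
  simp only [opCocycle]
  linarith

theorem exists_summable_upper_tail (hp : 1 < p)
    (hμ : MemLp (fun g => Real.log (bigN g)) (ENNReal.ofReal p) μ) {ε : ℝ} (hε : 0 < ε) :
    ∃ C : ℕ → ℝ, Summable (fun n : ℕ => (n : ℝ) ^ (p - 2) * C n) ∧
      ∀ n : ℕ, 1 ≤ n →
        (convPow μ n).real {g | n * (lyapunov μ + ε) ≤ Real.log (opNorm g)} ≤ C n := by
  obtain ⟨m, hm, hmean⟩ := exists_meanCocycle_opCocycle_le hp hμ (half_pos hε)
  obtain ⟨C, hC, h⟩ := isCocycle_opCocycle.exists_summable_tail μ hp measurable_log_bigN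
    log_bigN_nonneg hμ (integrable_log_bigN hp hμ) abs_opCocycle_le hm hmean (half_pos hε)
  refine ⟨C, hC, fun n hn => ?_⟩
  simpa [opCocycle, opNorm_one, add_assoc] using h n hn 1

theorem eventually_lintegral_log_opNorm_le (hp : 1 < p)
    (hμ : MemLp (fun g => Real.log (bigN g)) (ENNReal.ofReal p) μ) {ε : ℝ} (hε : 0 < ε) :
    ∀ᶠ n : ℕ in atTop, ∫⁻ g, ENNReal.ofReal (Real.log (opNorm g) - n * (lyapunov μ + ε))
      ∂(convPow μ n) ≤ ENNReal.ofReal (ε * n) := by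
  obtain ⟨m, hm, hmean⟩ := exists_meanCocycle_opCocycle_le hp hμ hε
  filter_upwards [isCocycle_opCocycle.eventually_lintegral_le μ hp measurable_log_bigN
    log_bigN_nonneg hμ (integrable_log_bigN hp hμ) abs_opCocycle_le hm hmean hε] with n hn
  simpa [opCocycle, opNorm_one] using hn 1

end Moment

end LinearGroup

theorem integral_max_zero_le {Ω : Type*} [MeasurableSpace Ω] {ν : Measure Ω} {f : Ω → ℝ} {a : ℝ}
    (hf : Integrable f ν) (ha : 0 ≤ a)
    (h : ∫⁻ ω, ENNReal.ofReal (f ω) ∂ν ≤ ENNReal.ofReal a) : ∫ ω, max (f ω) 0 ∂ν ≤ a := by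
  have h0 : 0 ≤ᵐ[ν] fun ω => max (f ω) 0 := .of_forall fun ω => le_max_right _ _
  rw [integral_eq_lintegral_of_nonneg_ae h0 hf.pos_part.aestronglyMeasurable]
  refine ENNReal.toReal_le_of_le_ofReal ha (le_trans (le_of_eq ?_) h)
  refine lintegral_congr fun ω => ?_
  rcases le_total (f ω) 0 with h | h
  · rw [max_eq_right h, ENNReal.ofReal_of_nonpos h, ENNReal.ofReal_zero]
  · rw [max_eq_left h]

/-! ### Lower deviations in the irreducible case -/

section Lower

variable {K V : Type*} [NontriviallyNormedField K] [NormedAddCommGroup V] [NormedSpace K V]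
  [Nontrivial V] [LocallyCompactSpace K] [FiniteDimensional K V]
  {p : ℝ} {μ : Measure (GLin K V)} [IsProbabilityMeasure μ]

/-- The infimum over the starting vector of the mean of the norm cocycle after `n` steps. -/
noncomputable def minMean (μ : Measure (GLin K V)) (n : ℕ) : ℝ :=
  ⨅ x, meanCocycle μ (vecCocycle (K := K) (V := V)) n x

instance nonempty_ne_zero : Nonempty {v : V // v ≠ 0} :=
  let ⟨v, hv⟩ := exists_ne (0 : V)
  ⟨⟨v, hv⟩⟩

theorem bddBelow_meanCocycle (hp : 1 < p)
    (hμ : MemLp (fun g => Real.log (bigN g)) (ENNReal.ofReal p) μ) (n : ℕ) :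
    BddBelow (Set.range fun x => meanCocycle μ (vecCocycle (K := K) (V := V)) n x) := by
  refine ⟨-(n * ∫ g, Real.log (bigN g) ∂μ), ?_⟩
  rintro _ ⟨x, rfl⟩
  exact (abs_le.1 (exists_abs_meanCocycle_le isCocycle_vecCocycle abs_vecCocycle_le hp hμ n x)).1

theorem minMean_le (hp : 1 < p)
    (hμ : MemLp (fun g => Real.log (bigN g)) (ENNReal.ofReal p) μ) (n : ℕ) (x : {v : V // v ≠ 0}) :
    minMean μ n ≤ meanCocycle μ vecCocycle n x :=
  ciInf_le (bddBelow_meanCocycle hp hμ n) x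

/-- Split the walk at time `n`: wherever it has arrived, the remaining `m` steps contribute at least
the minimum. -/
theorem minMean_add_le (hp : 1 < p)
    (hμ : MemLp (fun g => Real.log (bigN g)) (ENNReal.ofReal p) μ) (m n : ℕ) :
    minMean μ m + minMean μ n ≤ minMean μ (m + n) := by
  refine le_ciInf fun x => ?_
  rw [isCocycle_vecCocycle.meanCocycle_add μ (integrable_log_bigN hp hμ) abs_vecCocycle_le]
  refine add_le_add ?_ (minMean_le hp hμ n x)
  have h := integral_mono (μ := convPow μ n) (integrable_const (minMean μ m))
    (isCocycle_vecCocycle.integrable_meanCocycle μ (integrable_log_bigN hp hμ m)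
      abs_vecCocycle_le x) fun g => minMean_le hp hμ m (vecAct g x)
  simpa using h

theorem abs_minMean_le (hp : 1 < p)
    (hμ : MemLp (fun g => Real.log (bigN g)) (ENNReal.ofReal p) μ) (n : ℕ) :
    |minMean μ n| ≤ n * ∫ g, Real.log (bigN g) ∂μ := by
  have hb := fun x : {v : V // v ≠ 0} => abs_le.1
    (exists_abs_meanCocycle_le isCocycle_vecCocycle abs_vecCocycle_le hp hμ n x)
  obtain ⟨x⟩ := nonempty_ne_zero (V := V)
  exact abs_le.2 ⟨le_ciInf fun x => (hb x).1, (minMean_le hp hμ n x).trans (hb x).2⟩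

theorem exists_lowerExponent (hp : 1 < p)
    (hμ : MemLp (fun g => Real.log (bigN g)) (ENNReal.ofReal p) μ) :
    ∃ l : ℝ, (∀ n : ℕ, minMean μ n ≤ n * l) ∧
      ∀ ε : ℝ, 0 < ε → ∃ m : ℕ, m ≠ 0 ∧ m * (l - ε) ≤ minMean μ m := by
  have hsub : Subadditive fun n => -minMean μ n := fun m n => by
    have := minMean_add_le hp hμ m n
    simp only
    linarith
  have hb : BddBelow (Set.range fun n : ℕ => -minMean μ n / n) :=
    bddBelow_range_div fun n => by rw [abs_neg]; exact abs_minMean_le hp hμ n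
  refine ⟨-hsub.lim, fun n => ?_, fun ε hε => ?_⟩
  · rcases Nat.eq_zero_or_pos n with rfl | hn
    · simpa using (abs_le.1 (abs_minMean_le hp hμ 0)).2
    · have hn' : (0 : ℝ) < n := by exact_mod_cast hn
      have h := hsub.lim_le_div hb hn.ne'
      rw [le_div_iff₀ hn'] at h
      linarith
  · obtain ⟨m, hm, hm0⟩ := (((hsub.tendsto_lim hb).eventually_lt_const
      (show hsub.lim < hsub.lim + ε by linarith)).and (eventually_gt_atTop 0)).exists
    have hm' : (0 : ℝ) < m := by exact_mod_cast hm0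
    rw [div_lt_iff₀ hm'] at hm
    exact ⟨m, hm0.ne', by linarith⟩

theorem meanCocycle_neg_le (hp : 1 < p)
    (hμ : MemLp (fun g => Real.log (bigN g)) (ENNReal.ofReal p) μ) {m : ℕ} {c : ℝ}
    (hm : m * c ≤ minMean μ m) (x : {v : V // v ≠ 0}) :
    meanCocycle μ (fun g x => -vecCocycle g x) m x ≤ m * (-c) := by
  have h := minMean_le hp hμ m x
  rw [meanCocycle] at h ⊢
  rw [integral_neg]
  linarith

/-- Uniform complete convergence for the lower deviations of the norm cocycle. -/
theorem exists_summable_lower_tail (hp : 1 < p)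
    (hμ : MemLp (fun g => Real.log (bigN g)) (ENNReal.ofReal p) μ) {l : ℝ}
    (hl : ∀ ε : ℝ, 0 < ε → ∃ m : ℕ, m ≠ 0 ∧ m * (l - ε) ≤ minMean μ m) {ε : ℝ} (hε : 0 < ε) :
    ∃ C : ℕ → ℝ, Summable (fun n : ℕ => (n : ℝ) ^ (p - 2) * C n) ∧
      ∀ n : ℕ, 1 ≤ n → ∀ x : {v : V // v ≠ 0},
        (convPow μ n).real {g | vecCocycle g x ≤ n * (l - ε)} ≤ C n := by
  obtain ⟨m, hm, hmean⟩ := hl (ε / 2) (half_pos hε)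
  obtain ⟨C, hC, h⟩ := isCocycle_vecCocycle.neg.exists_summable_tail μ hp measurable_log_bigN
    log_bigN_nonneg hμ (integrable_log_bigN hp hμ)
    (fun g x => by rw [abs_neg]; exact abs_vecCocycle_le g x) hm
    (meanCocycle_neg_le hp hμ hmean) (half_pos hε)
  refine ⟨C, hC, fun n hn x => le_trans (measureReal_mono fun g hg => ?_) (h n hn x)⟩
  simp only [Set.mem_ofPred_eq] at hg ⊢
  linarith

theorem eventually_lintegral_lower_le (hp : 1 < p)
    (hμ : MemLp (fun g => Real.log (bigN g)) (ENNReal.ofReal p) μ) {l : ℝ}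
    (hl : ∀ ε : ℝ, 0 < ε → ∃ m : ℕ, m ≠ 0 ∧ m * (l - ε) ≤ minMean μ m) {ε : ℝ} (hε : 0 < ε) :
    ∀ᶠ n : ℕ in atTop, ∀ x : {v : V // v ≠ 0},
      ∫⁻ g, ENNReal.ofReal (n * (l - ε) - vecCocycle g x) ∂(convPow μ n) ≤
        ENNReal.ofReal (ε * n) := by
  obtain ⟨m, hm, hmean⟩ := hl ε hε
  filter_upwards [isCocycle_vecCocycle.neg.eventually_lintegral_le μ hp measurable_log_bigN
    log_bigN_nonneg hμ (integrable_log_bigN hp hμ)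
    (fun g x => by rw [abs_neg]; exact abs_vecCocycle_le g x) hm
    (meanCocycle_neg_le hp hμ hmean) hε] with n hn x
  refine le_trans (le_of_eq (lintegral_congr fun g => ?_)) (hn x)
  congr 1
  ring

/-- Since `|y| = y + 2 y⁻`, the `L¹` bound on lower deviations turns control of the mean into `L¹`
concentration around `n l`. -/
theorem eventually_integral_abs_sub_le (hp : 1 < p)
    (hμ : MemLp (fun g => Real.log (bigN g)) (ENNReal.ofReal p) μ) {l : ℝ}
    (hl : ∀ ε : ℝ, 0 < ε → ∃ m : ℕ, m ≠ 0 ∧ m * (l - ε) ≤ minMean μ m) {ε : ℝ} (hε : 0 < ε) :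
    ∀ᶠ n : ℕ in atTop, ∀ x : {v : V // v ≠ 0},
      ∫ g, |vecCocycle g x - n * l| ∂(convPow μ n) ≤
        meanCocycle μ vecCocycle n x - n * l + 4 * (ε * n) := by
  filter_upwards [eventually_lintegral_lower_le hp hμ hl hε] with n hn x
  have hi := isCocycle_vecCocycle.integrable (integrable_log_bigN hp hμ n) abs_vecCocycle_le x
  have hi1 : Integrable (fun g => n * (l - ε) - vecCocycle g x) (convPow μ n) :=
    (integrable_const _).sub hi
  have hi2 : Integrable (fun g => vecCocycle g x - n * l) (convPow μ n) :=
    hi.sub (integrable_const _)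
  have hεn : 0 ≤ ε * n := by positivity
  have h1 := integral_max_zero_le hi1 hεn (hn x)
  have hi3 : Integrable (fun g => 2 * max (n * (l - ε) - vecCocycle g x) 0) (convPow μ n) :=
    hi1.pos_part.const_mul 2
  calc ∫ g, |vecCocycle g x - n * l| ∂(convPow μ n)
      ≤ ∫ g, ((vecCocycle g x - n * l) +
          (2 * max (n * (l - ε) - vecCocycle g x) 0 + 2 * (ε * n))) ∂(convPow μ n) := by
        refine integral_mono hi2.abs (hi2.add (hi3.add (integrable_const _))) fun g => ?_
        have h2 := le_max_left (n * (l - ε) - vecCocycle g x) 0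
        have h3 := le_max_right (n * (l - ε) - vecCocycle g x) 0
        exact abs_le.2 ⟨by linarith, by linarith⟩
    _ = (meanCocycle μ vecCocycle n x - n * l) +
          (2 * ∫ g, max (n * (l - ε) - vecCocycle g x) 0 ∂(convPow μ n) + 2 * (ε * n)) := by
        have hi4 : Integrable (fun g => 2 * max (n * (l - ε) - vecCocycle g x) 0 + 2 * (ε * n))
          (convPow μ n) := hi3.add (integrable_const _)
        rw [integral_add hi2 hi4, integral_add hi3 (integrable_const _),
          integral_sub hi (integrable_const _), integral_const_mul 2]
        simp [meanCocycle]
    _ ≤ _ := by linarith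

/-- A vector near which there are, for most times `n` along the filter `F`, vectors whose mean
growth is almost minimal. -/
def IsSlow (F : Filter ℕ) (μ : Measure (GLin K V)) (u : V) : Prop :=
  ∀ U ∈ 𝓝 u, ∀ ε : ℝ, 0 < ε → ∀ᶠ n : ℕ in F, ∃ x : {v : V // v ≠ 0},
    (x : V) ∈ U ∧ meanCocycle μ vecCocycle n x ≤ minMean μ n + ε * n

omit [Nontrivial V] [LocallyCompactSpace K] [FiniteDimensional K V] [IsProbabilityMeasure μ] in
theorem meanCocycle_smul (n : ℕ) (x : {v : V // v ≠ 0}) {c : K} (hc : c ≠ 0)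
    (y : {v : V // v ≠ 0}) (hy : (y : V) = c • (x : V)) :
    meanCocycle μ vecCocycle n y = meanCocycle μ vecCocycle n x := by
  refine integral_congr_ae (.of_forall fun g => ?_)
  have : ‖c‖ ≠ 0 := norm_ne_zero_iff.2 hc
  simp only [vecCocycle, hy, map_smul, norm_smul]
  rw [mul_div_mul_left _ _ this]

-- Rescale almost minimising vectors into a compact shell, which plays the role of projective space,
-- and take their limit along the ultrafilter. The error `1` made in approaching the infimum is
-- below `ε * n` for large `n`.
omit [IsProbabilityMeasure μ] in
theorem exists_isSlow (F : Ultrafilter ℕ)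
    (hF : (F : Filter ℕ) ≤ atTop) : ∃ u : V, u ≠ 0 ∧ IsSlow (F : Filter ℕ) μ u := by
  have : ProperSpace K := ProperSpace.of_locallyCompactSpace K
  have : ProperSpace V := FiniteDimensional.proper K V
  obtain ⟨c, hc⟩ := NormedField.exists_one_lt_norm K
  have hc0 : 0 < ‖c‖ := by linarith
  set A : Set V := {v | ‖c‖⁻¹ ≤ ‖v‖} ∩ Metric.closedBall 0 1 with hA
  have hAc : IsCompact A :=
    (isCompact_closedBall (0 : V) 1).inter_left (isClosed_le continuous_const continuous_norm)
  have key : ∀ n : ℕ, ∃ y : {v : V // v ≠ 0}, (y : V) ∈ A ∧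
      meanCocycle μ vecCocycle n y ≤ minMean μ n + 1 := by
    intro n
    obtain ⟨x, hx⟩ := exists_lt_of_ciInf_lt (show minMean μ n < minMean μ n + 1 by linarith)
    obtain ⟨d, hd0, hd1, hd2, -⟩ := rescale_to_shell hc one_pos x.2
    refine ⟨⟨d • (x : V), smul_ne_zero hd0 x.2⟩, ⟨?_, ?_⟩, ?_⟩
    · simpa using hd2
    · simpa using hd1.le
    · rw [meanCocycle_smul n x hd0 _ rfl]
      exact hx.le
  choose y hyA hy using key
  obtain ⟨u, huA, hu⟩ := hAc.ultrafilter_le_nhds (F.map fun n => (y n : V))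
    (le_principal_iff.2 (Ultrafilter.mem_map.2 (Filter.univ_mem' hyA)))
  refine ⟨u, ?_, fun U hU ε hε => ?_⟩
  · rintro rfl
    have : ‖c‖⁻¹ ≤ ‖(0 : V)‖ := huA.1
    rw [norm_zero] at this
    exact absurd (inv_pos.2 hc0) (not_lt.2 this)
  · have h1 : ∀ᶠ n in (F : Filter ℕ), (y n : V) ∈ U := hu hU
    filter_upwards [h1, hF (tendsto_natCast_atTop_atTop.eventually_ge_atTop (1 / ε))] with n hn hn2
    refine ⟨y n, hn, (hy n).trans ?_⟩
    have : 1 / ε ≤ (n : ℝ) := hn2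
    rw [div_le_iff₀ hε] at this
    linarith

/-- The mean at `x` is, up to `2 * L`, the average over `h` of the means at `h x`, each at least the
minimum. If `x` is almost minimal, the means at `h x` cannot all exceed the minimum by `ε * n` on a
neighbourhood of `g` of mass `δ > 0`. -/
theorem IsSlow.apply (hp : 1 < p)
    (hμ : MemLp (fun g => Real.log (bigN g)) (ENNReal.ofReal p) μ) {F : Filter ℕ}
    (hF : F ≤ atTop) {u : V} (hu : IsSlow F μ u) {g : GLin K V} (hg : g ∈ μ.support) :
    IsSlow F μ ((g : V →L[K] V) u) := by
  intro U hU ε hε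
  have hcont : Continuous fun z : GLin K V × V => (z.1 : V →L[K] V) z.2 :=
    isBoundedBilinearMap_apply.continuous.comp
      ((Units.continuous_val.comp continuous_fst).prodMk continuous_snd)
  have hU' : (fun z : GLin K V × V => (z.1 : V →L[K] V) z.2) ⁻¹' U ∈ 𝓝 (g, u) :=
    hcont.continuousAt hU
  rw [nhds_prod_eq] at hU'
  obtain ⟨O, hO, U₁, hU₁, hOU⟩ := Filter.mem_prod_iff.1 hU'
  obtain ⟨O', hO'O, hO'o, hgO'⟩ := mem_nhds_iff.1 hO
  have hpos : 0 < μ.real O' := by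
    have := Measure.mem_support_iff_forall g |>.1 hg O' (hO'o.mem_nhds hgO')
    exact ENNReal.toReal_pos this.ne' (measure_ne_top _ _)
  set δ := μ.real O' with hδ
  set L := ∫ g, Real.log (bigN g) ∂μ with hL
  have hlarge := hF (tendsto_natCast_atTop_atTop.eventually_gt_atTop (4 * L / (ε * δ)))
  filter_upwards [hu U₁ hU₁ (ε * δ / 2) (by positivity), hlarge] with n hn hnL
  obtain ⟨x, hxU, hx⟩ := hn
  by_contra hcon
  push Not at hcon
  have hlow : ∀ h ∈ O', minMean μ n + ε * n < meanCocycle μ vecCocycle n (vecAct h x) :=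
    fun h hh => hcon (vecAct h x) (hOU (Set.mk_mem_prod (hO'O hh) hxU))
  have hξ := integrable_log_bigN hp hμ
  have hi := isCocycle_vecCocycle.integrable_meanCocycle μ (ν := μ) (hξ n) abs_vecCocycle_le x
  have h1 : minMean μ n + ε * n * δ ≤ ∫ h, meanCocycle μ vecCocycle n (vecAct h x) ∂μ := by
    have hi2 : Integrable (O'.indicator fun _ => ε * (n : ℝ)) μ :=
      (integrable_const _).indicator hO'o.measurableSet
    have h2 := integral_mono ((integrable_const (minMean μ n)).add hi2) hi fun h => by
      simp only [Pi.add_apply]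
      by_cases hh : h ∈ O'
      · rw [Set.indicator_of_mem hh]; exact (hlow h hh).le
      · rw [Set.indicator_of_notMem hh, add_zero]; exact minMean_le hp hμ n _
    rw [integral_add' (integrable_const _) hi2, integral_indicator hO'o.measurableSet] at h2
    simp only [integral_const, probReal_univ, smul_eq_mul,
      measureReal_restrict_apply_univ] at h2
    linarith
  -- Splitting `n + 1` steps after the first or before the last compares the averaged mean with the
  -- mean at `x`.
  have h2 := isCocycle_vecCocycle.meanCocycle_succ μ hξ abs_vecCocycle_le n x
  have h3 := isCocycle_vecCocycle.meanCocycle_add μ hξ abs_vecCocycle_le 1 n x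
  rw [add_comm 1 n] at h3
  have hone : ∀ y, |meanCocycle μ (vecCocycle (K := K) (V := V)) 1 y| ≤ L := fun y => by
    simpa using exists_abs_meanCocycle_le isCocycle_vecCocycle abs_vecCocycle_le hp hμ 1 y
  have h4 : ∫ h, meanCocycle μ vecCocycle 1 (vecAct h x) ∂(convPow μ n) ≤ L := by
    have := integral_mono (μ := convPow μ n)
      (isCocycle_vecCocycle.integrable_meanCocycle μ (hξ 1) abs_vecCocycle_le x)
      (integrable_const L) fun h => (abs_le.1 (hone (vecAct h x))).2
    simpa using this
  have h5 : -L ≤ ∫ h, vecCocycle h x ∂μ := by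
    have := (abs_le.1 (hone x)).1
    rwa [meanCocycle, convPow_one] at this
  have h6 : 4 * L < n * (ε * δ) := (div_lt_iff₀ (by positivity)).1 hnL
  linarith

theorem span_isSlow_eq_top (hp : 1 < p)
    (hμ : MemLp (fun g => Real.log (bigN g)) (ENNReal.ofReal p) μ)
    (hirr : ActsIrreducibly (semigroupOf μ)) (F : Ultrafilter ℕ)
    (hF : (F : Filter ℕ) ≤ atTop) :
    Submodule.span K {u : V | IsSlow (F : Filter ℕ) μ u} = ⊤ := by
  set W := Submodule.span K {u : V | IsSlow (F : Filter ℕ) μ u} with hW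
  have hsupp : ∀ g ∈ μ.support, ∀ w ∈ W, (g : V →L[K] V) w ∈ W := by
    intro g hg w hw
    have : W ≤ W.comap ((g : V →L[K] V) : V →ₗ[K] V) :=
      Submodule.span_le.2 fun u hu => Submodule.subset_span (IsSlow.apply hp hμ hF hu hg)
    exact this hw
  have hΓ : ∀ g ∈ semigroupOf μ, ∀ w ∈ W, (g : V →L[K] V) w ∈ W := by
    intro g hg
    induction hg using Subsemigroup.closure_induction with
    | mem g hg => exact hsupp g hg
    | mul g h _ _ hg hh => exact fun w hw => hg _ (hh w hw)
  refine (hirr.2 W hΓ).resolve_left fun h => ?_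
  obtain ⟨u, hu0, hu⟩ := exists_isSlow (μ := μ) F hF
  have : u ∈ W := Submodule.subset_span hu
  rw [h] at this
  exact hu0 ((Submodule.mem_bot K).1 this)

-- With `r = 1 / (2 * C)`, replacing `b i` by a nearby vector costs at most `‖g‖ / 2`, absorbed on
-- the left. The constants do not depend on the nearby vectors, which will vary with `n`.
omit [FiniteDimensional K V] in
theorem log_opNorm_le_of_near_basis {ι : Type*} [Fintype ι] (b : Module.Basis ι K V) :
    ∃ (r D : ℝ), 0 < r ∧ ∀ x : ι → {v : V // v ≠ 0}, (∀ i, (x i : V) ∈ Metric.ball (b i) r) →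
      ∀ (g : GLin K V) (a : ℝ), Real.log (opNorm g) ≤ D + a + ∑ i, |vecCocycle g (x i) - a| := by
  have : ProperSpace K := ProperSpace.of_locallyCompactSpace K
  obtain ⟨C, hC, hCb⟩ := b.exists_opNorm_le (F := V)
  set r := 1 / (2 * C) with hr
  have hr0 : 0 < r := by positivity
  set B := ∑ i, ‖b i‖ + r with hB
  have hB0 : 0 < B := by positivity
  refine ⟨r, Real.log (2 * C * B), hr0, fun x hx g a => ?_⟩
  set S := ∑ i, |vecCocycle g (x i) - a| with hS
  have hxi : ∀ i, ‖(g : V →L[K] V) (x i)‖ ≤ B * Real.exp (a + S) := by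
    intro i
    have hn : 0 < ‖(x i : V)‖ := norm_pos_iff.2 (x i).2
    have h1 : ‖(x i : V)‖ ≤ B := by
      have h2 : ‖(x i : V)‖ ≤ ‖b i‖ + r := by
        have h3 := mem_ball_iff_norm.1 (hx i)
        have h4 := norm_le_norm_add_norm_sub' (x i : V) (b i)
        linarith
      have h5 := Finset.single_le_sum (f := fun i => ‖b i‖) (fun i _ => norm_nonneg _)
        (Finset.mem_univ i)
      linarith
    have h2 : ‖(g : V →L[K] V) (x i)‖ = ‖(x i : V)‖ * Real.exp (vecCocycle g (x i)) := by
      rw [vecCocycle, Real.exp_log (div_pos (norm_pos_iff.2 (apply_ne_zero g (x i).2)) hn)]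
      field_simp
    rw [h2]
    have h5 : |vecCocycle g (x i) - a| ≤ S := Finset.single_le_sum
      (f := fun i => |vecCocycle g (x i) - a|) (fun i _ => abs_nonneg _) (Finset.mem_univ i)
    have h6 := (abs_le.1 h5).2
    gcongr
    linarith
  have h1 : opNorm g ≤ C * (B * Real.exp (a + S) + opNorm g * r) := by
    refine hCb (by have := opNorm_nonneg g; positivity) fun i => ?_
    have h2 : (g : V →L[K] V) (b i) = (g : V →L[K] V) (x i) - (g : V →L[K] V) (x i - b i) := by
      rw [map_sub]; abel
    rw [h2]
    refine (norm_sub_le _ _).trans (add_le_add (hxi i) ((norm_apply_le g _).trans ?_))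
    have := opNorm_nonneg g
    gcongr
    exact (mem_ball_iff_norm.1 (hx i)).le
  have h2 : opNorm g ≤ 2 * C * B * Real.exp (a + S) := by
    have : C * (opNorm g * r) = opNorm g / 2 := by rw [hr]; field_simp
    rw [mul_add, this] at h1
    linarith
  have h3 := Real.log_le_log (opNorm_pos g) h2
  rw [Real.log_mul (by positivity) (Real.exp_pos _).ne', Real.log_exp] at h3
  linarith

theorem lyapunov_le_of_slow_basis (hp : 1 < p)
    (hμ : MemLp (fun g => Real.log (bigN g)) (ENNReal.ofReal p) μ) {F : Filter ℕ} [F.NeBot]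
    (hF : F ≤ atTop) {l : ℝ} (hl₀ : ∀ n : ℕ, minMean μ n ≤ n * l)
    (hl : ∀ ε : ℝ, 0 < ε → ∃ m : ℕ, m ≠ 0 ∧ m * (l - ε) ≤ minMean μ m)
    {ι : Type*} [Fintype ι] (b : Module.Basis ι K V) (hb : ∀ i, IsSlow F μ (b i)) :
    lyapunov μ ≤ l := by
  obtain ⟨r, D, hr, hD⟩ := log_opNorm_le_of_near_basis b
  refine le_of_forall_pos_le_add fun ε' hε' => ?_
  set d := (Fintype.card ι : ℝ) with hd
  have hd0 : 0 ≤ d := Nat.cast_nonneg _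
  -- Each basis vector costs `5 * ε * n`: `ε` from slowness and `4 * ε` from concentration. One more
  -- `ε` absorbs `D`.
  set ε := ε' / (5 * d + 1) with hε
  have hε0 : 0 < ε := by positivity
  have h1 : ∀ᶠ n : ℕ in F, ∀ i, ∃ x : {v : V // v ≠ 0}, (x : V) ∈ Metric.ball (b i) r ∧
      meanCocycle μ vecCocycle n x ≤ minMean μ n + ε * n :=
    eventually_all.2 fun i => hb i _ (Metric.ball_mem_nhds _ hr) ε hε0
  obtain ⟨n, hn, hn2, hn3, hn0⟩ := (h1.and (hF ((eventually_integral_abs_sub_le hp hμ hl hε0).and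
    ((tendsto_natCast_atTop_atTop.eventually_ge_atTop (D / ε)).and (eventually_gt_atTop 0))))).exists
  choose x hxb hx using hn
  have hn' : (0 : ℝ) < n := by exact_mod_cast hn0
  rw [div_le_iff₀ hε0] at hn3
  have hi : ∀ i, Integrable (fun g => |vecCocycle g (x i) - n * l|) (convPow μ n) := fun i =>
    ((isCocycle_vecCocycle.integrable (integrable_log_bigN hp hμ n) abs_vecCocycle_le (x i)).sub
      (integrable_const _)).abs
  have h2 : n * lyapunov μ ≤ D + n * l + ∑ _i : ι, 5 * (ε * n) := by
    calc n * lyapunov μ ≤ ∫ g, Real.log (opNorm g) ∂(convPow μ n) :=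
          (tendsto_lyapunov_and_le hp hμ).2 n hn0.ne'
      _ ≤ ∫ g, (D + n * l + ∑ i, |vecCocycle g (x i) - n * l|) ∂(convPow μ n) :=
          integral_mono (integrable_log_opNorm hp hμ n)
            ((integrable_const _).add (integrable_finsetSum _ fun i _ => hi i))
            fun g => hD x hxb g (n * l)
      _ = D + n * l + ∑ i, ∫ g, |vecCocycle g (x i) - n * l| ∂(convPow μ n) := by
          rw [integral_add (integrable_const _) (integrable_finsetSum _ fun i _ => hi i),
            integral_finsetSum _ fun i _ => hi i]
          simp
      _ ≤ D + n * l + ∑ _i : ι, 5 * (ε * n) := by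
          gcongr with i
          have := hn2 (x i)
          have := hx i
          have := hl₀ n
          linarith
  rw [Finset.sum_const, Finset.card_univ, nsmul_eq_mul, ← hd] at h2
  have h3 : ε' = 5 * d * ε + ε := by
    rw [hε]; field_simp
  have h4 : n * lyapunov μ ≤ n * (l + ε') := by rw [h3]; linarith
  exact le_of_mul_le_mul_left h4 hn'

theorem lyapunov_le_of_irreducible (hp : 1 < p)
    (hμ : MemLp (fun g => Real.log (bigN g)) (ENNReal.ofReal p) μ)
    (hirr : ActsIrreducibly (semigroupOf μ)) {l : ℝ} (hl₀ : ∀ n : ℕ, minMean μ n ≤ n * l)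
    (hl : ∀ ε : ℝ, 0 < ε → ∃ m : ℕ, m ≠ 0 ∧ m * (l - ε) ≤ minMean μ m) :
    lyapunov μ ≤ l := by
  have hF : ((Filter.hyperfilter ℕ : Ultrafilter ℕ) : Filter ℕ) ≤ atTop :=
    Nat.hyperfilter_le_atTop
  have hspan := span_isSlow_eq_top hp hμ hirr (Filter.hyperfilter ℕ) hF
  have := FiniteDimensional.fintypeBasisIndex (Module.Basis.ofSpan hspan.ge)
  exact lyapunov_le_of_slow_basis hp hμ hF hl₀ hl (Module.Basis.ofSpan hspan.ge)
    fun i => Module.Basis.ofSpan_subset hspan.ge (Set.mem_range_self i)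

/-- Complete convergence for the lower deviations of the norm cocycle in the irreducible case. -/
theorem exists_summable_lower_tail_of_irreducible (hp : 1 < p)
    (hμ : MemLp (fun g => Real.log (bigN g)) (ENNReal.ofReal p) μ)
    (hirr : ActsIrreducibly (semigroupOf μ)) {ε : ℝ} (hε : 0 < ε) :
    ∃ C : ℕ → ℝ, Summable (fun n : ℕ => (n : ℝ) ^ (p - 2) * C n) ∧
      ∀ n : ℕ, 1 ≤ n → ∀ x : {v : V // v ≠ 0},
        (convPow μ n).real {g | vecCocycle g x ≤ n * (lyapunov μ - ε)} ≤ C n := by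
  obtain ⟨l, hl₀, hl⟩ := exists_lowerExponent hp hμ
  have hle := lyapunov_le_of_irreducible hp hμ hirr hl₀ hl
  obtain ⟨C, hC, h⟩ := exists_summable_lower_tail hp hμ hl hε
  refine ⟨C, hC, fun n hn x => le_trans (measureReal_mono fun g hg => ?_) (h n hn x)⟩
  simp only [Set.mem_ofPred_eq] at hg ⊢
  exact hg.trans (by gcongr)

end Lower

/-! ### Images of convolution powers -/

section Homomorphism

variable {G H : Type*} [Group G] [MeasurableSpace G] [MeasurableMul₂ G]
  [Group H] [MeasurableSpace H] [MeasurableMul₂ H]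

theorem ae_mem_convPow (μ : Measure G) [IsProbabilityMeasure μ] {S : Subgroup G}
    (hS : MeasurableSet (S : Set G)) (hμ : ∀ᵐ g ∂μ, g ∈ S) (n : ℕ) :
    ∀ᵐ g ∂(convPow μ n), g ∈ S := by
  have hS' : MeasurableSet {g | g ∈ S} := hS
  induction n with
  | zero =>
    rw [convPow, ae_dirac_iff hS']
    exact S.one_mem
  | succ n ih =>
    rw [convPow, Measure.mconv, ae_map_iff measurable_mul.aemeasurable hS']
    filter_upwards [Measure.quasiMeasurePreserving_fst.ae ih,
      Measure.quasiMeasurePreserving_snd.ae hμ] with z h1 h2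
    exact S.mul_mem h1 h2

theorem convPow_map (μ : Measure G) [IsProbabilityMeasure μ] {S : Subgroup G}
    (hS : MeasurableSet (S : Set G)) (hμ : ∀ᵐ g ∂μ, g ∈ S) {ρ : G → H} (hρ : Measurable ρ)
    (h1 : ρ 1 = 1) (hmul : ∀ g ∈ S, ∀ h ∈ S, ρ (g * h) = ρ g * ρ h) (n : ℕ) :
    convPow (μ.map ρ) n = (convPow μ n).map ρ := by
  have : IsProbabilityMeasure (μ.map ρ) := Measure.isProbabilityMeasure_map hρ.aemeasurable
  induction n with
  | zero => rw [convPow, convPow, Measure.map_dirac' hρ, h1]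
  | succ n ih =>
    rw [convPow, ih, convPow, Measure.mconv, Measure.mconv, Measure.map_prod_map _ _ hρ hρ,
      Measure.map_map (by fun_prop) (hρ.prodMap hρ), Measure.map_map hρ (by fun_prop)]
    refine Measure.map_congr ?_
    filter_upwards [Measure.quasiMeasurePreserving_fst.ae (ae_mem_convPow μ hS hμ n),
      Measure.quasiMeasurePreserving_snd.ae hμ] with z hz1 hz2
    exact (hmul _ hz1 _ hz2).symm

end Homomorphism

/-! ### Subquotient representations -/

section Compression

variable {K V E : Type*} [NontriviallyNormedField K] [NormedAddCommGroup V] [NormedSpace K V]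
  [NormedAddCommGroup E] [NormedSpace K E]

/-- Complete convergence for the lower deviations of the norm. -/
def HasLowerTail (p : ℝ) (μ : Measure (GLin K V)) : Prop :=
  ∀ ε : ℝ, 0 < ε → ∃ C : ℕ → ℝ, Summable (fun n : ℕ => (n : ℝ) ^ (p - 2) * C n) ∧
    ∀ n : ℕ, 1 ≤ n →
      (convPow μ n).real {g | Real.log (opNorm g) ≤ n * (lyapunov μ - ε)} ≤ C n

/-- The pair `i : E → V`, `π : V → E` exhibits `E` as a subquotient of the representation of the
subgroup `S` of `GL(V)`. -/
structure IsCompression (S : Subgroup (GLin K V)) (i : E →L[K] V) (π : V →L[K] E) : Prop where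
  left_inv : ∀ e, π (i e) = e
  mul : ∀ g ∈ S, ∀ h ∈ S, ∀ e, π ((g : V →L[K] V) (i (π ((h : V →L[K] V) (i e))))) =
    π ((g : V →L[K] V) ((h : V →L[K] V) (i e)))

variable {S : Subgroup (GLin K V)} {i : E →L[K] V} {π : V →L[K] E}

open Classical in
/-- The operator induced on a subquotient `E` by an element of `S`; it is `1` outside `S`. -/
noncomputable def IsCompression.toGL (H : IsCompression S i π) (g : GLin K V) : GLin K E :=
  if hg : g ∈ S then
    { val := π.comp ((g : V →L[K] V).comp i)
      inv := π.comp (((g⁻¹ : GLin K V) : V →L[K] V).comp i)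
      val_inv := by
        ext e
        simp [H.mul g hg _ (S.inv_mem hg), apply_inv_apply, H.left_inv]
      inv_val := by
        ext e
        simp [H.mul _ (S.inv_mem hg) g hg, inv_apply_apply, H.left_inv] }
  else 1

variable (H : IsCompression S i π)

include H

theorem IsCompression.toGL_apply {g : GLin K V} (hg : g ∈ S) (e : E) :
    (H.toGL g : E →L[K] E) e = π ((g : V →L[K] V) (i e)) := by
  simp [toGL, hg]

theorem IsCompression.toGL_one : H.toGL 1 = 1 := by
  ext e
  simp [H.toGL_apply S.one_mem, H.left_inv]

theorem IsCompression.toGL_mul {g h : GLin K V} (hg : g ∈ S) (hh : h ∈ S) :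
    H.toGL (g * h) = H.toGL g * H.toGL h := by
  ext e
  simp [H.toGL_apply (S.mul_mem hg hh), H.toGL_apply hg, H.toGL_apply hh, H.mul g hg h hh]

theorem IsCompression.toGL_inv {g : GLin K V} (hg : g ∈ S) : H.toGL g⁻¹ = (H.toGL g)⁻¹ := by
  rw [eq_inv_iff_mul_eq_one, ← H.toGL_mul (S.inv_mem hg) hg, inv_mul_cancel, H.toGL_one]

theorem IsCompression.measurable_toGL (hS : MeasurableSet (S : Set (GLin K V))) :
    Measurable H.toGL := by
  classical
  refine measurable_comap_iff.2 ?_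
  have h1 : (Units.val ∘ H.toGL) = fun g : GLin K V => if g ∈ (S : Set (GLin K V)) then
      π.comp ((g : V →L[K] V).comp i) else 1 := by
    ext g : 1
    by_cases hg : g ∈ S <;> simp [toGL, hg]
  rw [h1]
  refine Measurable.ite hS ?_ measurable_const
  have h2 : Continuous fun A : V →L[K] V => π.comp (A.comp i) :=
    continuous_const.clm_comp (continuous_id.clm_comp continuous_const)
  exact h2.measurable.comp (comap_measurable _)

theorem IsCompression.opNorm_toGL_le {g : GLin K V} (hg : g ∈ S) :
    opNorm (H.toGL g) ≤ ‖π‖ * ‖i‖ * opNorm g := by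
  have h : (H.toGL g : E →L[K] E) = π.comp ((g : V →L[K] V).comp i) := by
    ext e; simp [H.toGL_apply hg]
  rw [opNorm, h, mul_assoc, mul_comm ‖i‖]
  exact (ContinuousLinearMap.opNorm_comp_le _ _).trans
    (mul_le_mul_of_nonneg_left (ContinuousLinearMap.opNorm_comp_le _ _) (norm_nonneg _))

theorem IsCompression.bigN_toGL_le {g : GLin K V} (hg : g ∈ S) :
    bigN (H.toGL g) ≤ ‖π‖ * ‖i‖ * bigN g := by
  refine max_le ((H.opNorm_toGL_le hg).trans ?_) ?_
  · gcongr; exact opNorm_le_bigN g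
  · rw [← H.toGL_inv hg]
    refine (H.opNorm_toGL_le (S.inv_mem hg)).trans ?_
    gcongr; exact opNorm_inv_le_bigN g

variable [Nontrivial V] [Nontrivial E]

omit [Nontrivial V] in
theorem IsCompression.norm_mul_norm_pos : 0 < ‖π‖ * ‖i‖ := by
  have h1 : π ≠ 0 := by
    rintro rfl
    obtain ⟨e, he⟩ := exists_ne (0 : E)
    exact he (H.left_inv e).symm
  have h2 : i ≠ 0 := by
    rintro rfl
    obtain ⟨e, he⟩ := exists_ne (0 : E)
    exact he (by simpa using (H.left_inv e).symm)
  exact mul_pos (norm_pos_iff.2 h1) (norm_pos_iff.2 h2)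

theorem IsCompression.log_bigN_toGL_le {g : GLin K V} (hg : g ∈ S) :
    Real.log (bigN (H.toGL g)) ≤ Real.log (‖π‖ * ‖i‖) + Real.log (bigN g) := by
  rw [← Real.log_mul H.norm_mul_norm_pos.ne' (bigN_pos g).ne']
  exact Real.log_le_log (bigN_pos _) (H.bigN_toGL_le hg)

theorem IsCompression.log_opNorm_toGL_le {g : GLin K V} (hg : g ∈ S) :
    Real.log (opNorm (H.toGL g)) ≤ Real.log (‖π‖ * ‖i‖) + Real.log (opNorm g) := by
  rw [← Real.log_mul H.norm_mul_norm_pos.ne' (opNorm_pos g).ne']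
  exact Real.log_le_log (opNorm_pos _) (H.opNorm_toGL_le hg)

variable [LocallyCompactSpace K] [FiniteDimensional K V] [FiniteDimensional K E]
  {p : ℝ} {μ : Measure (GLin K V)} [IsProbabilityMeasure μ]

omit [FiniteDimensional K V] in
theorem IsCompression.memLp_map (hS : MeasurableSet (S : Set (GLin K V))) (hμS : ∀ᵐ g ∂μ, g ∈ S)
    (hμ : MemLp (fun g => Real.log (bigN g)) (ENNReal.ofReal p) μ) :
    MemLp (fun g => Real.log (bigN g)) (ENNReal.ofReal p) (μ.map H.toGL) := by
  have hm := H.measurable_toGL hS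
  rw [memLp_map_measure_iff measurable_log_bigN.aestronglyMeasurable hm.aemeasurable]
  refine ((memLp_const (Real.log (‖π‖ * ‖i‖))).add hμ).mono
    (measurable_log_bigN.comp hm).aestronglyMeasurable ?_
  filter_upwards [hμS] with g hg
  have h1 := H.log_bigN_toGL_le hg
  have h2 := log_bigN_nonneg (H.toGL g)
  simp only [Function.comp_apply, Pi.add_apply]
  rw [Real.norm_of_nonneg h2, Real.norm_of_nonneg (h2.trans h1)]
  exact h1

omit [Nontrivial V] [Nontrivial E] in
theorem IsCompression.convPow_map (hS : MeasurableSet (S : Set (GLin K V)))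
    (hμS : ∀ᵐ g ∂μ, g ∈ S) (n : ℕ) :
    convPow (μ.map H.toGL) n = (convPow μ n).map H.toGL :=
  RandomWalkGL.convPow_map μ hS hμS (H.measurable_toGL hS) H.toGL_one
    (fun _ hg _ hh => H.toGL_mul hg hh) n

/-- The norm of the induced operator is at most a constant times `‖g‖`. An unusually small `‖g‖`
thus forces a small induced norm, a deviation downstairs when the exponent there is no smaller. -/
theorem IsCompression.hasLowerTail (hS : MeasurableSet (S : Set (GLin K V)))
    (hμS : ∀ᵐ g ∂μ, g ∈ S) (hle : lyapunov μ ≤ lyapunov (μ.map H.toGL))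
    (h : HasLowerTail p (μ.map H.toGL)) : HasLowerTail p μ := by
  intro ε hε
  obtain ⟨C, hC, hCn⟩ := h (ε / 2) (half_pos hε)
  set A := |Real.log (‖π‖ * ‖i‖)| with hA
  refine ⟨fun n => C n + if n < ⌈2 * A / ε⌉₊ then 1 else 0,
    summable_of_finite_correction hC _, fun n hn => ?_⟩
  have hC0 : 0 ≤ C n := measureReal_nonneg.trans (hCn n hn)
  by_cases hN : n < ⌈2 * A / ε⌉₊
  · simp only [if_pos hN]
    exact measureReal_le_one.trans (by linarith)
  · simp only [if_neg hN, add_zero]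
    have h1 : 2 * A / ε ≤ n := Nat.ceil_le.1 (not_lt.1 hN)
    rw [div_le_iff₀ hε] at h1
    refine le_trans ?_ (hCn n hn)
    have hms : MeasurableSet {g : GLin K E | Real.log (opNorm g) ≤
        n * (lyapunov (μ.map H.toGL) - ε / 2)} :=
      measurableSet_le (Real.measurable_log.comp measurable_opNorm) measurable_const
    rw [H.convPow_map hS hμS, map_measureReal_apply (H.measurable_toGL hS) hms]
    refine ENNReal.toReal_mono (measure_ne_top _ _) (measure_mono_ae ?_)
    filter_upwards [ae_mem_convPow μ hS hμS n] with g hg hgl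
    have h2 := H.log_opNorm_toGL_le hg
    have h3 : Real.log (opNorm g) ≤ n * (lyapunov μ - ε) := hgl
    have h4 := le_abs_self (Real.log (‖π‖ * ‖i‖))
    have h5 : (n : ℝ) * lyapunov μ ≤ n * lyapunov (μ.map H.toGL) := by gcongr
    show Real.log (opNorm (H.toGL g)) ≤ n * (lyapunov (μ.map H.toGL) - ε / 2)
    linarith

theorem IsCompression.eventually_integral_le (hp : 1 < p)
    (hS : MeasurableSet (S : Set (GLin K V))) (hμS : ∀ᵐ g ∂μ, g ∈ S)
    (hμ : MemLp (fun g => Real.log (bigN g)) (ENNReal.ofReal p) μ) {ε l : ℝ} (hε : 0 < ε)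
    (hl : lyapunov (μ.map H.toGL) ≤ l) :
    ∀ᶠ n : ℕ in atTop,
      Integrable (fun g => max (Real.log (opNorm (H.toGL g)) - n * (l + ε)) 0) (convPow μ n) ∧
      ∫ g, max (Real.log (opNorm (H.toGL g)) - n * (l + ε)) 0 ∂(convPow μ n) ≤ ε * n := by
  have hm := H.measurable_toGL hS
  have : IsProbabilityMeasure (μ.map H.toGL) := Measure.isProbabilityMeasure_map hm.aemeasurable
  have hν := H.memLp_map hS hμS hμ
  filter_upwards [eventually_lintegral_log_opNorm_le hp hν hε] with n hn
  have hi : Integrable (fun g => Real.log (opNorm g) - n * (l + ε))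
      (convPow (μ.map H.toGL) n) := (integrable_log_opNorm hp hν n).sub (integrable_const _)
  have h1 := integral_max_zero_le hi (by positivity : 0 ≤ ε * n) (le_trans (lintegral_mono
    fun g => ENNReal.ofReal_le_ofReal (by gcongr)) hn)
  have h2 := hi.pos_part
  rw [H.convPow_map hS hμS] at h1 h2
  rw [integral_map hm.aemeasurable h2.aestronglyMeasurable] at h1
  exact ⟨(integrable_map_measure h2.aestronglyMeasurable hm.aemeasurable).1 h2, h1⟩

end Compression

/-! ### Invariant subspaces and block triangular form -/

section Block

variable {K V : Type*} [NontriviallyNormedField K] [NormedAddCommGroup V] [NormedSpace K V]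

/-- The stabiliser in `GL(V)` of a subspace. -/
def stabSubgroup (W : Submodule K V) : Subgroup (GLin K V) where
  carrier := {g | ∀ w ∈ W, (g : V →L[K] V) w ∈ W ∧ ((g⁻¹ : GLin K V) : V →L[K] V) w ∈ W}
  mul_mem' {g h} hg hh w hw := by
    rw [mul_inv_rev]
    exact ⟨(hg _ (hh w hw).1).1, (hh _ (hg w hw).2).2⟩
  one_mem' w hw := by simpa using hw
  inv_mem' {g} hg w hw := by
    rw [inv_inv]
    exact (hg w hw).symm

theorem mem_stabSubgroup_of_forall [FiniteDimensional K V] {W : Submodule K V} {g : GLin K V}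
    (hg : ∀ w ∈ W, (g : V →L[K] V) w ∈ W) : g ∈ stabSubgroup W := by
  refine fun w hw => ⟨hg w hw, ?_⟩
  set f : W →ₗ[K] W := ((g : V →L[K] V) : V →ₗ[K] V).restrict hg with hf
  have hinj : Function.Injective f := by
    intro x y hxy
    have h1 : (g : V →L[K] V) x = (g : V →L[K] V) y := congrArg Subtype.val hxy
    have h2 := congrArg ((g⁻¹ : GLin K V) : V →L[K] V) h1
    rw [inv_apply_apply, inv_apply_apply] at h2
    exact Subtype.ext h2
  obtain ⟨y, hy⟩ := (LinearMap.injective_iff_surjective.1 hinj) ⟨w, hw⟩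
  have h1 : (g : V →L[K] V) y = w := congrArg Subtype.val hy
  rw [← h1, inv_apply_apply]
  exact y.2

variable [LocallyCompactSpace K] [FiniteDimensional K V]

theorem measurableSet_stabSubgroup (W : Submodule K V) :
    MeasurableSet (stabSubgroup W : Set (GLin K V)) := by
  have : ProperSpace K := ProperSpace.of_locallyCompactSpace K
  have hW : IsClosed (W : Set V) := W.closed_of_finiteDimensional
  have h1 : (stabSubgroup W : Set (GLin K V)) = {g : GLin K V | ∀ w ∈ W, (g : V →L[K] V) w ∈ W} := by
    ext g
    exact ⟨fun h w hw => (h w hw).1, fun h => mem_stabSubgroup_of_forall h⟩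
  rw [h1]
  have h2 : IsClosed {g : GLin K V | ∀ w ∈ W, (g : V →L[K] V) w ∈ W} := by
    simp only [Set.ofPred_forall]
    exact isClosed_iInter fun w => isClosed_iInter fun _ => hW.preimage (continuous_apply w)
  exact h2.measurableSet

theorem ae_mem_stabSubgroup {W : Submodule K V} (μ : Measure (GLin K V))
    (hW : ∀ g ∈ semigroupOf μ, ∀ w ∈ W, (g : V →L[K] V) w ∈ W) :
    ∀ᵐ g ∂μ, g ∈ stabSubgroup W := by
  filter_upwards [Measure.support_mem_ae (μ := μ)] with g hg
  exact mem_stabSubgroup_of_forall (hW g (Subsemigroup.subset_closure hg))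

variable {W U : Submodule K V} (h : IsCompl W U)

/-- The continuous projection onto `W` along a complement. -/
noncomputable def contProj (h : IsCompl W U) : V →L[K] W :=
  haveI : ProperSpace K := ProperSpace.of_locallyCompactSpace K
  LinearMap.toContinuousLinearMap (W.projectionOnto U h)

theorem contProj_apply (v : V) : contProj h v = W.projectionOnto U h v := rfl

theorem contProj_of_mem {v : V} (hv : v ∈ W) : (contProj h v : V) = v := by
  rw [contProj_apply, Submodule.projectionOnto_apply_of_mem_left h hv]

theorem contProj_eq_zero {v : V} (hv : v ∈ U) : contProj h v = 0 := by
  rw [contProj_apply, Submodule.projectionOnto_apply_eq_zero_iff]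
  exact hv

theorem contProj_add_contProj (v : V) : (contProj h v : V) + (contProj h.symm v : V) = v :=
  Submodule.projection_add_projection_eq_self h v

theorem isCompression_sub :
    IsCompression (stabSubgroup W) W.subtypeL (contProj h) where
  left_inv e := Subtype.ext (contProj_of_mem h e.2)
  mul g _ k hk e := by
    simp only [Submodule.subtypeL_apply]
    rw [contProj_of_mem h (hk _ e.2).1]

/-- `U` stands for `V / W`: the `W`-component discarded between the two operators is mapped into `W`
by `g`, then killed by the projection. -/
theorem isCompression_quotient :
    IsCompression (stabSubgroup W) U.subtypeL (contProj h.symm) where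
  left_inv e := Subtype.ext (contProj_of_mem h.symm e.2)
  mul g hg k hk e := by
    simp only [Submodule.subtypeL_apply]
    set v := (k : V →L[K] V) e with hv
    conv_rhs => rw [← contProj_add_contProj h v, map_add, map_add,
      contProj_eq_zero h.symm (hg _ (contProj h v).2).1, zero_add]

/-- The operator which is `1` on `W` and `c` on `U`. -/
noncomputable def scaleGL {c : K} (hc : c ≠ 0) : GLin K V where
  val := W.subtypeL.comp (contProj h) + c • U.subtypeL.comp (contProj h.symm)
  inv := W.subtypeL.comp (contProj h) + c⁻¹ • U.subtypeL.comp (contProj h.symm)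
  val_inv := by
    ext v
    simp [contProj_eq_zero h (contProj h.symm v).2, contProj_eq_zero h.symm (contProj h v).2,
      contProj_of_mem h (contProj h v).2, contProj_of_mem h.symm (contProj h.symm v).2,
      smul_smul, mul_inv_cancel₀ hc, contProj_add_contProj]
  inv_val := by
    ext v
    simp [contProj_eq_zero h (contProj h.symm v).2, contProj_eq_zero h.symm (contProj h v).2,
      contProj_of_mem h (contProj h v).2, contProj_of_mem h.symm (contProj h.symm v).2,
      smul_smul, inv_mul_cancel₀ hc, contProj_add_contProj]

theorem scaleGL_apply {c : K} (hc : c ≠ 0) (v : V) : (scaleGL h hc : V →L[K] V) v =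
    (contProj h v : V) + c • (contProj h.symm v : V) := rfl

theorem scaleGL_inv_apply {c : K} (hc : c ≠ 0) (v : V) :
    ((scaleGL h hc)⁻¹ : GLin K V).val v =
    (contProj h v : V) + c⁻¹ • (contProj h.symm v : V) := rfl

/-- Conjugation keeps both diagonal blocks and multiplies the block from `U` to `W` by `c⁻¹`. It is
essential that `β` does not depend on `c`. -/
theorem exists_opNorm_conj_le : ∃ β : ℝ, 1 ≤ β ∧ ‖contProj h‖ * ‖W.subtypeL‖ ≤ β ∧
    ∀ (c : K) (hc : c ≠ 0), ∀ g ∈ stabSubgroup W,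
      opNorm (scaleGL h hc * g * (scaleGL h hc)⁻¹) ≤
        β * (opNorm ((isCompression_sub h).toGL g) + opNorm ((isCompression_quotient h).toGL g) +
          ‖c‖⁻¹ * opNorm g) := by
  set P := contProj h with hP
  set Q := contProj h.symm with hQ
  set a := ‖P‖ * ‖W.subtypeL‖ with ha
  set β := 1 + a + ‖P‖ + ‖Q‖ + ‖P‖ * ‖Q‖ with hβ
  have ha0 : 0 ≤ a := by positivity
  have h1 : (0 : ℝ) ≤ ‖P‖ * ‖Q‖ := by positivity
  have hβ0 : 0 ≤ β := by positivity
  have hPβ : ‖P‖ ≤ β := by linarith [norm_nonneg Q]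
  have hQβ : ‖Q‖ ≤ β := by linarith [norm_nonneg P]
  have hPQβ : ‖P‖ * ‖Q‖ ≤ β := by linarith [norm_nonneg P, norm_nonneg Q]
  refine ⟨β, by linarith [norm_nonneg P, norm_nonneg Q],
    by linarith [norm_nonneg P, norm_nonneg Q], fun c hc g hg => ?_⟩
  set A := (isCompression_sub h).toGL g with hA
  set D := (isCompression_quotient h).toGL g with hD
  have hA0 := opNorm_nonneg A
  have hD0 := opNorm_nonneg D
  have hg0 := opNorm_nonneg g
  refine ContinuousLinearMap.opNorm_le_bound _ (by positivity) fun v => ?_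
  have key : ((scaleGL h hc * g * (scaleGL h hc)⁻¹ : GLin K V) : V →L[K] V) v =
      ((A : W →L[K] W) (P v) : V) + ((D : U →L[K] U) (Q v) : V) +
        c⁻¹ • (P ((g : V →L[K] V) (Q v)) : V) := by
    have e1 : ((scaleGL h hc * g * (scaleGL h hc)⁻¹ : GLin K V) : V →L[K] V) v =
        (scaleGL h hc : V →L[K] V) ((g : V →L[K] V) (((scaleGL h hc)⁻¹ : GLin K V).val v)) := rfl
    rw [e1, scaleGL_inv_apply, scaleGL_apply, map_add, map_smul,
      (isCompression_sub h).toGL_apply hg, (isCompression_quotient h).toGL_apply hg]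
    have hw := (hg _ (P v).2).1
    simp only [Submodule.subtypeL_apply, map_add, map_smul, Submodule.coe_add,
      Submodule.coe_smul, smul_add, smul_smul, mul_inv_cancel₀ hc, one_smul, ← hP, ← hQ]
    rw [show Q ((g : V →L[K] V) (P v)) = 0 from contProj_eq_zero h.symm hw]
    simp only [Submodule.coe_zero, smul_zero, zero_add]
    abel
  rw [key]
  have b1 : ‖((A : W →L[K] W) (P v) : V)‖ ≤ β * opNorm A * ‖v‖ := by
    have e1 : ‖(A : W →L[K] W) (P v)‖ ≤ opNorm A * ‖P v‖ := norm_apply_le A _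
    have e2 : ‖P v‖ ≤ β * ‖v‖ := (P.le_opNorm v).trans (by gcongr)
    calc ‖(A : W →L[K] W) (P v)‖ ≤ opNorm A * ‖P v‖ := e1
      _ ≤ opNorm A * (β * ‖v‖) := by gcongr
      _ = _ := by ring
  have b2 : ‖((D : U →L[K] U) (Q v) : V)‖ ≤ β * opNorm D * ‖v‖ := by
    have e1 : ‖(D : U →L[K] U) (Q v)‖ ≤ opNorm D * ‖Q v‖ := norm_apply_le D _
    have e2 : ‖Q v‖ ≤ β * ‖v‖ := (Q.le_opNorm v).trans (by gcongr)
    calc ‖(D : U →L[K] U) (Q v)‖ ≤ opNorm D * ‖Q v‖ := e1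
      _ ≤ opNorm D * (β * ‖v‖) := by gcongr
      _ = _ := by ring
  have b3 : ‖c⁻¹ • (P ((g : V →L[K] V) (Q v)) : V)‖ ≤ β * (‖c‖⁻¹ * opNorm g) * ‖v‖ := by
    rw [norm_smul, norm_inv]
    have e1 : ‖P ((g : V →L[K] V) (Q v))‖ ≤ ‖P‖ * (opNorm g * (‖Q‖ * ‖v‖)) := by
      refine (P.le_opNorm _).trans ?_
      gcongr
      refine (norm_apply_le g _).trans ?_
      gcongr
      exact Q.le_opNorm v
    calc ‖c‖⁻¹ * ‖P ((g : V →L[K] V) (Q v))‖ ≤ ‖c‖⁻¹ * (‖P‖ * (opNorm g * (‖Q‖ * ‖v‖))) := by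
          gcongr
      _ = (‖P‖ * ‖Q‖) * (‖c‖⁻¹ * opNorm g) * ‖v‖ := by ring
      _ ≤ β * (‖c‖⁻¹ * opNorm g) * ‖v‖ := by gcongr
  refine (norm_add₃_le).trans ?_
  linarith

end Block

/-! ### The exponent of a reducible walk -/

section Reducible

variable {K V : Type*} [NontriviallyNormedField K] [NormedAddCommGroup V] [NormedSpace K V]
  [Nontrivial V] [LocallyCompactSpace K] [FiniteDimensional K V]
  {p : ℝ} {μ : Measure (GLin K V)} [IsProbabilityMeasure μ]

omit [LocallyCompactSpace K] [FiniteDimensional K V] in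
theorem abs_log_opNorm_conj_sub_le (T g : GLin K V) :
    |Real.log (opNorm (T * g * T⁻¹)) - Real.log (opNorm g)| ≤ 2 * Real.log (bigN T) := by
  have h1 := log_opNorm_mul_le (T * g) T⁻¹
  have h2 := log_opNorm_mul_le T g
  have h3 := log_opNorm_mul_le T⁻¹ (T * g * T⁻¹ * T)
  have h4 := log_opNorm_mul_le (T * g * T⁻¹) T
  have h5 : T⁻¹ * (T * g * T⁻¹ * T) = g := by group
  rw [h5] at h3
  have h6 := log_opNorm_le T
  have h7 := log_opNorm_le T⁻¹
  rw [bigN_inv] at h7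
  exact abs_le.2 ⟨by linarith, by linarith⟩

theorem integrable_log_opNorm_conj (hp : 1 < p)
    (hμ : MemLp (fun g => Real.log (bigN g)) (ENNReal.ofReal p) μ) (T : GLin K V) (n : ℕ) :
    Integrable (fun g => Real.log (opNorm (T * g * T⁻¹))) (convPow μ n) := by
  have h1 : Integrable (fun g => Real.log (opNorm (T * g * T⁻¹)) - Real.log (opNorm g))
      (convPow μ n) := by
    refine (integrable_const (2 * Real.log (bigN T))).mono' (Measurable.aestronglyMeasurable ?_)
      (.of_forall fun g => abs_log_opNorm_conj_sub_le T g)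
    exact (Real.measurable_log.comp (measurable_opNorm.comp
      ((measurable_id.const_mul T).mul_const T⁻¹))).sub (Real.measurable_log.comp measurable_opNorm)
  refine (h1.add (integrable_log_opNorm hp hμ n)).congr (.of_forall fun g => ?_)
  simp

/-- The first Lyapunov exponent is at most the normalised mean of the logarithm of any conjugate
operator norm. -/
theorem mul_lyapunov_le_integral_conj (hp : 1 < p)
    (hμ : MemLp (fun g => Real.log (bigN g)) (ENNReal.ofReal p) μ) (T : GLin K V) {m : ℕ}
    (hm : m ≠ 0) :
    m * lyapunov μ ≤ ∫ g, Real.log (opNorm (T * g * T⁻¹)) ∂(convPow μ m) := by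
  have hi := integrable_log_opNorm_conj hp hμ T
  have hi0 := integrable_log_opNorm hp hμ
  have hsub := integral_convPow_subadditive μ hi fun g k => by
    have := log_opNorm_mul_le (T * g * T⁻¹) (T * k * T⁻¹)
    rwa [show T * g * T⁻¹ * (T * k * T⁻¹) = T * (g * k) * T⁻¹ by group] at this
  set B := 2 * Real.log (bigN T) with hB
  -- A bounded change of `log ‖g‖` does not affect the limit, so Fekete's infimum for the conjugated
  -- sequence is still `λ₁`.
  have hdiff : ∀ n : ℕ, |∫ g, Real.log (opNorm (T * g * T⁻¹)) ∂(convPow μ n) -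
      ∫ g, Real.log (opNorm g) ∂(convPow μ n)| ≤ B := by
    intro n
    rw [← integral_sub (hi n) (hi0 n)]
    refine abs_integral_le_integral_abs.trans ?_
    have := integral_mono ((hi n).sub (hi0 n)).abs (integrable_const B)
      fun g => abs_log_opNorm_conj_sub_le T g
    simpa using this
  have hlim : Tendsto (fun n : ℕ => (∫ g, Real.log (opNorm (T * g * T⁻¹)) ∂(convPow μ n)) / n)
      atTop (𝓝 (lyapunov μ)) := by
    have h0 : Tendsto (fun n : ℕ => (∫ g, Real.log (opNorm (T * g * T⁻¹)) ∂(convPow μ n)) / n -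
        (∫ g, Real.log (opNorm g) ∂(convPow μ n)) / n) atTop (𝓝 0) := by
      refine squeeze_zero_norm (fun n => ?_) (tendsto_const_div_atTop_nhds_zero_nat B)
      rw [← sub_div, norm_div, Real.norm_natCast]
      gcongr
      exact hdiff n
    simpa using h0.add (tendsto_lyapunov_and_le hp hμ).1
  have hb := hlim.bddBelow_range
  have hm' : (0 : ℝ) < m := by exact_mod_cast Nat.pos_of_ne_zero hm
  have h1 := hsub.lim_le_div hb hm
  rw [tendsto_nhds_unique (hsub.tendsto_lim hb) hlim, le_div_iff₀ hm'] at h1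
  linarith

theorem tendsto_integral_log_one_add (hp : 1 < p)
    (hμ : MemLp (fun g => Real.log (bigN g)) (ENNReal.ofReal p) μ) (m : ℕ) {β r : ℝ} (hβ : 0 ≤ β)
    (hr0 : 0 ≤ r) (hr1 : r < 1) :
    (∀ k : ℕ, Integrable (fun g => Real.log (1 + r ^ k * (β * bigN g ^ 2))) (convPow μ m)) ∧
    Tendsto (fun k : ℕ => ∫ g, Real.log (1 + r ^ k * (β * bigN g ^ 2)) ∂(convPow μ m)) atTop
      (𝓝 0) := by
  have hmeas : ∀ k : ℕ, AEStronglyMeasurable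
      (fun g : GLin K V => Real.log (1 + r ^ k * (β * bigN g ^ 2))) (convPow μ m) := fun k =>
    (Real.measurable_log.comp (((measurable_bigN.pow_const 2).const_mul β).const_mul
      (r ^ k) |>.const_add 1)).aestronglyMeasurable
  have hbi : Integrable (fun g => Real.log (1 + β) + 2 * Real.log (bigN g)) (convPow μ m) :=
    (integrable_const _).add ((integrable_log_bigN hp hμ m).const_mul 2)
  have hbound : ∀ k : ℕ, ∀ g : GLin K V, ‖Real.log (1 + r ^ k * (β * bigN g ^ 2))‖ ≤
      Real.log (1 + β) + 2 * Real.log (bigN g) := by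
    intro k g
    have hN := one_le_bigN g
    have h1 : r ^ k ≤ 1 := pow_le_one₀ hr0 hr1.le
    have h2 : 0 ≤ r ^ k := by positivity
    have h3 : 0 ≤ β * bigN g ^ 2 := by positivity
    rw [Real.norm_of_nonneg (Real.log_nonneg (by nlinarith [mul_nonneg h2 h3]))]
    have h4 : Real.log (1 + β) + 2 * Real.log (bigN g) = Real.log ((1 + β) * bigN g ^ 2) := by
      rw [Real.log_mul (by positivity) (by positivity), Real.log_pow]; norm_num
    rw [h4]
    refine Real.log_le_log (by positivity) ?_
    have h5 : 1 ≤ bigN g ^ 2 := one_le_pow₀ hN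
    have h6 := mul_le_mul_of_nonneg_right h1 h3
    linarith
  refine ⟨fun k => hbi.mono' (hmeas k) (.of_forall (hbound k)), ?_⟩
  have h := tendsto_integral_of_dominated_convergence (μ := convPow μ m) (f := fun _ => (0 : ℝ))
    _ hmeas hbi (fun k => .of_forall (hbound k)) (.of_forall fun g => by
      have h1 : Tendsto (fun k : ℕ => 1 + r ^ k * (β * bigN g ^ 2)) atTop (𝓝 1) := by
        have := ((tendsto_pow_atTop_nhds_zero_of_lt_one hr0 hr1).mul_const
          (β * bigN g ^ 2)).const_add 1
        simpa using this
      have := (Real.continuousAt_log one_ne_zero).tendsto.comp h1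
      simpa [Function.comp_def] using this)
  simpa using h

variable {W U : Submodule K V} (h : IsCompl W U) [Nontrivial W] [Nontrivial U]

theorem exists_log_opNorm_conj_le : ∃ β : ℝ, 1 ≤ β ∧
    ∀ (c : K) (hc : c ≠ 0), ∀ g ∈ stabSubgroup W, ∀ a : ℝ,
      Real.log (opNorm (scaleGL h hc * g * (scaleGL h hc)⁻¹)) ≤ Real.log (2 * β) + a +
        max (Real.log (opNorm ((isCompression_sub h).toGL g)) - a) 0 +
        max (Real.log (opNorm ((isCompression_quotient h).toGL g)) - a) 0 +
        Real.log (1 + ‖c‖⁻¹ * (β * bigN g ^ 2)) := by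
  obtain ⟨β, hβ1, hβ2, hβ⟩ := exists_opNorm_conj_le h
  refine ⟨β, hβ1, fun c hc g hg a => ?_⟩
  have hmain := hβ c hc g hg
  set A := (isCompression_sub h).toGL g with hA
  set D := (isCompression_quotient h).toGL g with hD
  have hA0 := opNorm_pos A
  have hD0 := opNorm_pos D
  have hg0 := opNorm_pos g
  have hN := bigN_pos g
  have hβ0 : 0 < β := by linarith
  set x := max (Real.log (opNorm A) - a) 0 with hx
  set y := max (Real.log (opNorm D) - a) 0 with hy
  have hx0 : 0 ≤ x := le_max_right _ _
  have hy0 : 0 ≤ y := le_max_right _ _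
  have hAx : opNorm A ≤ Real.exp (a + x + y) := by
    rw [← Real.log_le_iff_le_exp hA0]
    linarith [le_max_left (Real.log (opNorm A) - a) 0]
  have hDy : opNorm D ≤ Real.exp (a + x + y) := by
    rw [← Real.log_le_iff_le_exp hD0]
    linarith [le_max_left (Real.log (opNorm D) - a) 0]
  -- Comparing the off-diagonal term with `‖A‖` lets the size of the diagonal blocks factor out.
  -- What remains is a logarithm tending to `0` as `‖c‖ → ∞`.
  have hgA : opNorm g ≤ opNorm A * (β * bigN g ^ 2) := by
    have h1 := one_le_opNorm_mul_inv A
    have h2 : opNorm A⁻¹ ≤ β * bigN g :=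
      (opNorm_inv_le_bigN A).trans (((isCompression_sub h).bigN_toGL_le hg).trans (by gcongr))
    calc opNorm g ≤ bigN g := opNorm_le_bigN g
      _ ≤ (opNorm A * opNorm A⁻¹) * bigN g := le_mul_of_one_le_left hN.le h1
      _ ≤ (opNorm A * (β * bigN g)) * bigN g := by gcongr
      _ = _ := by ring
  have h3 : opNorm (scaleGL h hc * g * (scaleGL h hc)⁻¹) ≤
      2 * β * Real.exp (a + x + y) * (1 + ‖c‖⁻¹ * (β * bigN g ^ 2)) := by
    refine hmain.trans ?_
    have e1 : opNorm A + opNorm D + ‖c‖⁻¹ * opNorm g ≤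
        2 * Real.exp (a + x + y) * (1 + ‖c‖⁻¹ * (β * bigN g ^ 2)) := by
      have e2 : ‖c‖⁻¹ * opNorm g ≤ ‖c‖⁻¹ * (Real.exp (a + x + y) * (β * bigN g ^ 2)) := by
        gcongr
        exact hgA.trans (by gcongr)
      have e3 : 0 ≤ ‖c‖⁻¹ * (Real.exp (a + x + y) * (β * bigN g ^ 2)) := by positivity
      linarith
    calc _ ≤ β * (2 * Real.exp (a + x + y) * (1 + ‖c‖⁻¹ * (β * bigN g ^ 2))) := by gcongr
      _ = _ := by ring
  have h4 := Real.log_le_log (opNorm_pos _) h3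
  have e5 : (0 : ℝ) < 1 + ‖c‖⁻¹ * (β * bigN g ^ 2) := by positivity
  rw [Real.log_mul (by positivity) e5.ne', Real.log_mul (by positivity) (Real.exp_pos _).ne',
    Real.log_exp] at h4
  linarith

/-- The first Lyapunov exponent of a reducible random walk is attained on an invariant subspace or
on the corresponding quotient. -/
theorem lyapunov_le_max (hp : 1 < p)
    (hμ : MemLp (fun g => Real.log (bigN g)) (ENNReal.ofReal p) μ)
    (hS : ∀ᵐ g ∂μ, g ∈ stabSubgroup W) :
    lyapunov μ ≤ max (lyapunov (μ.map (isCompression_sub h).toGL))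
      (lyapunov (μ.map (isCompression_quotient h).toGL)) := by
  set l := max (lyapunov (μ.map (isCompression_sub h).toGL))
    (lyapunov (μ.map (isCompression_quotient h).toGL)) with hl
  obtain ⟨β, hβ1, hβ⟩ := exists_log_opNorm_conj_le h
  obtain ⟨c, hc1⟩ := NormedField.exists_one_lt_norm K
  have hc0 : c ≠ 0 := norm_pos_iff.1 (by linarith)
  have hmeas := measurableSet_stabSubgroup W
  refine le_of_forall_pos_le_add fun ε' hε' => ?_
  set ε := ε' / 4 with hε
  have hε0 : 0 < ε := by positivity
  obtain ⟨m, ⟨hi1, h1⟩, ⟨hi2, h2⟩, hm, hm0⟩ :=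
    (((isCompression_sub h).eventually_integral_le hp hmeas hS hμ hε0 (le_max_left _ _)).and
      (((isCompression_quotient h).eventually_integral_le hp hmeas hS hμ hε0
        (le_max_right _ _)).and
      ((tendsto_natCast_atTop_atTop.eventually_ge_atTop (Real.log (2 * β) / ε)).and
        (eventually_gt_atTop 0)))).exists
  rw [div_le_iff₀ hε0] at hm
  have hm' : (0 : ℝ) < m := by exact_mod_cast hm0
  have hr1 : ‖c‖⁻¹ < 1 := inv_lt_one_of_one_lt₀ hc1
  obtain ⟨hi3, h3⟩ := tendsto_integral_log_one_add hp hμ m (by linarith : 0 ≤ β)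
    (inv_nonneg.2 (norm_nonneg c)) hr1
  -- The time `m` is already fixed; conjugating by the scalar `c ^ k` and letting `k → ∞` removes
  -- the last integral.
  have hk : ∀ k : ℕ, m * lyapunov μ ≤ Real.log (2 * β) + m * (l + ε) + ε * m + ε * m +
      ∫ g, Real.log (1 + ‖c‖⁻¹ ^ k * (β * bigN g ^ 2)) ∂(convPow μ m) := by
    intro k
    have hck : c ^ k ≠ 0 := pow_ne_zero k hc0
    refine (mul_lyapunov_le_integral_conj hp hμ (scaleGL h hck) hm0.ne').trans ?_
    have hI1 := (integrable_const (μ := convPow μ m) (Real.log (2 * β) + m * (l + ε))).add hi1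
    have hI2 := hI1.add hi2
    have hle := integral_mono_ae (integrable_log_opNorm_conj hp hμ (scaleGL h hck) m)
      (hI2.add (hi3 k)) (by
        filter_upwards [ae_mem_convPow μ hmeas hS m] with g hg
        have := hβ (c ^ k) hck g hg (m * (l + ε))
        rwa [norm_pow, ← inv_pow] at this)
    refine hle.trans ?_
    rw [integral_add' hI2 (hi3 k), integral_add' hI1 hi2, integral_add' (integrable_const _) hi1]
    simp only [integral_const, probReal_univ, one_smul]
    gcongr
  have h4 : m * lyapunov μ ≤ Real.log (2 * β) + m * (l + ε) + ε * m + ε * m :=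
    ge_of_tendsto' (by
      simpa only [add_zero] using h3.const_add
        (Real.log (2 * β) + m * (l + ε) + ε * m + ε * m)) hk
  have h5 : m * lyapunov μ ≤ m * (l + ε') := by
    have : ε' = 4 * ε := by rw [hε]; ring
    rw [this]; linarith
  exact le_of_mul_le_mul_left h5 hm'

end Reducible

/-! ### Lower deviations of the norm by induction on the dimension -/

section LowerTail

variable {K : Type*} [NontriviallyNormedField K] [LocallyCompactSpace K]

theorem hasLowerTail_of_irreducible {V : Type*} [NormedAddCommGroup V] [NormedSpace K V]
    [FiniteDimensional K V] [Nontrivial V] {p : ℝ} (hp : 1 < p) {μ : Measure (GLin K V)}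
    [IsProbabilityMeasure μ] (hμ : MemLp (fun g => Real.log (bigN g)) (ENNReal.ofReal p) μ)
    (hirr : ActsIrreducibly (semigroupOf μ)) : HasLowerTail p μ := by
  intro ε hε
  obtain ⟨C, hC, h⟩ := exists_summable_lower_tail_of_irreducible hp hμ hirr hε
  obtain ⟨x⟩ := nonempty_ne_zero (V := V)
  exact ⟨C, hC, fun n hn => (measureReal_mono fun g hg => (vecCocycle_le g x).trans hg).trans
    (h n hn x)⟩

universe v in
theorem hasLowerTail_of_finrank {p : ℝ} (hp : 1 < p) (d : ℕ) :
    ∀ (V : Type v) [NormedAddCommGroup V] [NormedSpace K V] [FiniteDimensional K V]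
      [Nontrivial V] (μ : Measure (GLin K V)) [IsProbabilityMeasure μ],
      MemLp (fun g => Real.log (bigN g)) (ENNReal.ofReal p) μ → Module.finrank K V = d →
      HasLowerTail p μ := by
  induction d using Nat.strong_induction_on with
  | _ d ih =>
  intro V _ _ _ _ μ _ hμ hd
  by_cases hirr : ActsIrreducibly (semigroupOf μ)
  · exact hasLowerTail_of_irreducible hp hμ hirr
  · simp only [ActsIrreducibly, not_and, not_forall, not_or] at hirr
    obtain ⟨W, hW, hW0, hW1⟩ := hirr inferInstance
    obtain ⟨U, h⟩ := W.exists_isCompl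
    have hS := ae_mem_stabSubgroup μ hW
    have hmeas := measurableSet_stabSubgroup W
    have hU0 : U ≠ ⊥ := fun hU => hW1 (by simpa [hU] using h.sup_eq_top)
    have hU1 : U ≠ ⊤ := fun hU => hW0 (by simpa [hU] using h.inf_eq_bot)
    have : Nontrivial W := Submodule.nontrivial_iff_ne_bot.2 hW0
    have : Nontrivial U := Submodule.nontrivial_iff_ne_bot.2 hU0
    -- The induction continues on whichever of `W` and `V / W` has exponent at least `λ₁`.
    rcases le_max_iff.1 (lyapunov_le_max h hp hμ hS) with hle | hle
    · have : IsProbabilityMeasure (μ.map (isCompression_sub h).toGL) :=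
        Measure.isProbabilityMeasure_map ((isCompression_sub h).measurable_toGL hmeas).aemeasurable
      exact (isCompression_sub h).hasLowerTail hmeas hS hle
        (ih _ (hd ▸ Submodule.finrank_lt hW1) W _
          ((isCompression_sub h).memLp_map hmeas hS hμ) rfl)
    · have : IsProbabilityMeasure (μ.map (isCompression_quotient h).toGL) :=
        Measure.isProbabilityMeasure_map
          ((isCompression_quotient h).measurable_toGL hmeas).aemeasurable
      exact (isCompression_quotient h).hasLowerTail hmeas hS hle
        (ih _ (hd ▸ Submodule.finrank_lt hU1) U _
          ((isCompression_quotient h).memLp_map hmeas hS hμ) rfl)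

end LowerTail

/-! ### Two-sided deviations -/

section Deviations

variable {K V : Type*} [NontriviallyNormedField K] [LocallyCompactSpace K]
  [NormedAddCommGroup V] [NormedSpace K V] [FiniteDimensional K V]
  {p : ℝ} {μ : Measure (GLin K V)} [IsProbabilityMeasure μ]

omit [LocallyCompactSpace K] [FiniteDimensional K V] in
theorem opNorm_of_subsingleton [Subsingleton V] (g : GLin K V) : opNorm g = 0 := by
  simp [opNorm, Subsingleton.elim (g : V →L[K] V) 0]

omit [LocallyCompactSpace K] [FiniteDimensional K V] in
theorem lyapunov_of_subsingleton [Subsingleton V] (μ : Measure (GLin K V)) : lyapunov μ = 0 := by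
  simp only [lyapunov, opNorm_of_subsingleton, Real.log_zero, integral_zero, mul_zero]
  exact tendsto_const_nhds.limUnder_eq

omit [FiniteDimensional K V] in
omit [LocallyCompactSpace K] in
theorem measureReal_abs_sub_ge_le {ν : Measure (GLin K V)} [IsProbabilityMeasure ν]
    {f : GLin K V → ℝ} {ε l a b : ℝ} {n : ℕ} (hup : ν.real {g | n * (l + ε) ≤ f g} ≤ a)
    (hlow : ν.real {g | f g ≤ n * (l - ε)} ≤ b) :
    ν.real {g | ε * n ≤ |f g - n * l|} ≤ a + b := by
  refine (measureReal_mono (s₂ := {g | n * (l + ε) ≤ f g} ∪ {g | f g ≤ n * (l - ε)})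
    fun g hg => ?_).trans ((measureReal_union_le _ _).trans (add_le_add hup hlow))
  have hg' : ε * n ≤ |f g - n * l| := hg
  rcases le_abs.1 hg' with h | h
  · left
    show n * (l + ε) ≤ f g
    linarith
  · right
    show f g ≤ n * (l - ε)
    linarith

/-- Complete convergence for the norm and, in the irreducible case, the norm cocycle. -/
theorem exists_summable_deviation [Nontrivial V] (hp : 1 < p)
    (hμ : MemLp (fun g => Real.log (bigN g)) (ENNReal.ofReal p) μ) {ε : ℝ} (hε : 0 < ε) :
    ∃ C : ℕ → ℝ, Summable (fun n : ℕ => (n : ℝ) ^ (p - 2) * C n) ∧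
      (∀ n : ℕ, 1 ≤ n →
        (convPow μ n).real {g | ε * n ≤ |Real.log (opNorm g) - n * lyapunov μ|} ≤ C n) ∧
      (ActsIrreducibly (semigroupOf μ) → ∀ n : ℕ, 1 ≤ n → ∀ x : {v : V // v ≠ 0},
        (convPow μ n).real {g | ε * n ≤ |vecCocycle g x - n * lyapunov μ|} ≤ C n) := by
  obtain ⟨C₁, hC₁, hup⟩ := exists_summable_upper_tail hp hμ hε
  obtain ⟨C₂, hC₂, hlow, hlow'⟩ : ∃ C : ℕ → ℝ, Summable (fun n : ℕ => (n : ℝ) ^ (p - 2) * C n) ∧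
      (∀ n : ℕ, 1 ≤ n →
        (convPow μ n).real {g | Real.log (opNorm g) ≤ n * (lyapunov μ - ε)} ≤ C n) ∧
      (ActsIrreducibly (semigroupOf μ) → ∀ n : ℕ, 1 ≤ n → ∀ x : {v : V // v ≠ 0},
        (convPow μ n).real {g | vecCocycle g x ≤ n * (lyapunov μ - ε)} ≤ C n) := by
    -- One sequence must serve both bounds. In the irreducible case the vector bound implies the
    -- norm bound, because `‖gv‖ / ‖v‖ ≤ ‖g‖`; otherwise only the norm bound is required.
    by_cases hirr : ActsIrreducibly (semigroupOf μ)
    · obtain ⟨C, hC, h⟩ := exists_summable_lower_tail_of_irreducible hp hμ hirr hε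
      obtain ⟨x⟩ := nonempty_ne_zero (V := V)
      exact ⟨C, hC, fun n hn => (measureReal_mono fun g hg =>
        (vecCocycle_le g x).trans hg).trans (h n hn x), fun _ => h⟩
    · obtain ⟨C, hC, h⟩ := hasLowerTail_of_finrank hp _ V μ hμ rfl ε hε
      exact ⟨C, hC, h, fun h' => absurd h' hirr⟩
  refine ⟨fun n => C₁ n + C₂ n, ?_, fun n hn => ?_, fun hirr n hn x => ?_⟩
  · simp_rw [mul_add]
    exact hC₁.add hC₂
  · exact measureReal_abs_sub_ge_le (hup n hn) (hlow n hn)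
  · refine measureReal_abs_sub_ge_le ?_ (hlow' hirr n hn x)
    exact (measureReal_mono fun g hg => le_trans hg (vecCocycle_le g x)).trans (hup n hn)

end Deviations

end RandomWalkGL

theorem proposition4p1 {K V : Type*} [NontriviallyNormedField K] [LocallyCompactSpace K]
    [NormedAddCommGroup V] [NormedSpace K V] [FiniteDimensional K V]
    (p : ℝ) (hp : 1 < p)
    (μ : Measure (RandomWalkGL.GLin K V)) [IsProbabilityMeasure μ]
    (hμ : Integrable (fun g => Real.log (RandomWalkGL.bigN g) ^ p) μ) :
    -- the integrals and the limit that define the Lyapunov exponent `λ₁` exist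
    (∀ n : ℕ, Integrable (fun g => Real.log (RandomWalkGL.opNorm g))
      (RandomWalkGL.convPow μ n)) ∧
    Tendsto (fun n : ℕ => (1 / (n : ℝ)) *
        ∫ g, Real.log (RandomWalkGL.opNorm g) ∂(RandomWalkGL.convPow μ n))
      atTop (𝓝 (RandomWalkGL.lyapunov μ)) ∧
    ∀ ε : ℝ, 0 < ε → ∃ C : ℕ → ℝ,
      Summable (fun n : ℕ => (n : ℝ) ^ (p - 2) * C n) ∧
      (∀ n : ℕ, 1 ≤ n →
        (RandomWalkGL.convPow μ n).real
          {g | ε * n ≤ |Real.log (RandomWalkGL.opNorm g) - n * RandomWalkGL.lyapunov μ|}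
            ≤ C n) ∧
      (RandomWalkGL.ActsIrreducibly (RandomWalkGL.semigroupOf μ) →
        ∀ n : ℕ, 1 ≤ n → ∀ v : V, v ≠ 0 →
          (RandomWalkGL.convPow μ n).real
            {g | ε * n ≤ |Real.log (‖(g : V →L[K] V) v‖ / ‖v‖)
              - n * RandomWalkGL.lyapunov μ|}
              ≤ C n) := by
  -- For `V = 0` all logarithms are `log 0 = 0`, so `λ₁ = 0` and `C = 0` works.
  rcases subsingleton_or_nontrivial V with hV | hV
  · refine ⟨fun n => ?_, ?_, fun ε hε => ⟨0, by simp, fun n hn => ?_,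
      fun _ n _ v hv => absurd (Subsingleton.elim v 0) hv⟩⟩
    · simp [RandomWalkGL.opNorm_of_subsingleton]
    · simp [RandomWalkGL.opNorm_of_subsingleton, RandomWalkGL.lyapunov_of_subsingleton]
    · have hn' : (0 : ℝ) < n := by exact_mod_cast hn
      have : ¬ ε * n ≤ 0 := not_le.2 (by positivity)
      simp [RandomWalkGL.opNorm_of_subsingleton, RandomWalkGL.lyapunov_of_subsingleton, this]
  · have hμ' := RandomWalkGL.memLp_log_bigN hp hμ
    refine ⟨RandomWalkGL.integrable_log_opNorm hp hμ', ?_, fun ε hε => ?_⟩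
    · simpa [div_eq_inv_mul] using (RandomWalkGL.tendsto_lyapunov_and_le hp hμ').1
    · obtain ⟨C, hC, h1, h2⟩ := RandomWalkGL.exists_summable_deviation hp hμ' hε
      exact ⟨C, hC, h1, fun hirr n hn v hv => h2 hirr n hn ⟨v, hv⟩⟩
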